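/- Let $m\ge 2$, let $\theta\in\mathbb R$ with $\sin\theta\ne 0$, let $\lambda_i>0$, and write $\jmath=\sqrt{-1}$. Let $Q=\begin{bmatrix}\cos\theta&\sin\theta\\-\sin\theta&\cos\theta\end{bmatrix}$ and let $A\in\mathbb R^{2m\times 2m}$ be the real Jordan block with $Q$ in the $m$ diagonal $2\times 2$ blocks, $I_2$ in the $m-1$ superdiagonal $2\times 2$ blocks, and zeros elsewhere. For real constants $c_1,\dots,c_{2m}$ and $\varepsilon>0$ let $K\in\mathbb R^{2m\times 2m}$ be the matrix whose only nonzero row is the last one, $[k_1,\dots,k_{2m}]$, where $$k_{2j-1}=c_{2j-1}\varepsilon^{m-j},\quad k_{2j}=c_{2j}\varepsilon^{m-j}\quad(1\le j\le m-1),\qquad k_{2m-1}=c_{2m-1}\varepsilon,\quad k_{2m}=c_{2m}\varepsilon .$$ Let $A_i=A-\lambda_iK$ and let $\rho_i$ be the spectral radius of $A_i$. Put $$R_m=\tfrac12+\tfrac12(c_{2m-1}\sin\theta-c_{2m}\cos\theta),\qquad H=\operatorname{Re}\Big[\frac{c_{2m-5}\jmath-c_{2m-4}}{c_{2m-3}\jmath-c_{2m-2}}\,e^{-\jmath\theta}\Big]\quad(m\ge3).$$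 Assume that $c_{2m-3}=-\sin2\theta$ and $c_{2m-2}=\cos2\theta$, and moreover: * if $m=2$, that $R_2<0$; * if $m\ge3$, that $\lambda_iR_m+H<0$, that the equation $\sum_{j=1}^{m-1}(c_{2j}-c_{2j-1}\jmath)\,\vartheta^{\,j-1}=0$ has $m-2$ distinct roots, denoted $\vartheta_{n1}$, $n=3,\dots,m$, and that $\operatorname{Re}(\vartheta_{n1}e^{-\jmath\theta})<0$ for all $n$. Then there is $\varepsilon_0>0$ such that for all $0<\varepsilon<\varepsilon_0$, all $\xi\in\mathbb R^{2m}$ and all integers $s\ge0$, the entries $\xi_{s,1},\dots,\xi_{s,2m}$ of $A_i^s\xi$ satisfy $$|\xi_{s,2j-1}|,\ |\xi_{s,2j}|\ \le\ \begin{cases}\|\xi\|\,M_{ij}\,\rho_i^s\,\varepsilon^{\,j-(m-1)}, & 1\le j\le m-2,\\ \|\xi\|\,M_{ij}\,\rho_i^s\,\varepsilon^{(j-m)/2}, & j=m-1,\,m,\end{cases}$$ where $\|\xi\|$ is the Euclidean norm and $$M_{ij}=\begin{cases}\dfrac{5}{2\lambda_i}\displaystyle\sum_{n=3}^m\frac{|\vartheta_{n1}|^{j-1}}{\prod_{3\le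 k\le m,\,k\ne n}|\vartheta_{k1}-\vartheta_{n1}|}, & 1\le j\le m-3,\\[3mm] \dfrac{5}{2\lambda_i}\Big(\displaystyle\sum_{n=3}^m\frac{|\vartheta_{n1}|^{m-3}}{\prod_{3\le k\le m,\,k\ne n}|\vartheta_{k1}-\vartheta_{n1}|}+1\Big), & j=m-2,\\[3mm] \dfrac{3}{\sqrt{2\lambda_i}}, & j=m-1,\\[2mm] \dfrac52, & j=m.\end{cases}$$ -/

import Mathlib

open scoped Matrix

noncomputable section

namespace Oscillator

/-! Coordinates of `ℝ^{2m}` are indexed by `Fin m × Fin 2`: for `j = 1, …, m`, the pair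
`(j - 1, 0)` stands for the coordinate `2j - 1` and `(j - 1, 1)` for the coordinate `2j`. -/

/-- The rotation block `Q`. -/
def rot (θ : ℝ) : Matrix (Fin 2) (Fin 2) ℝ :=
  !![Real.cos θ, Real.sin θ; -Real.sin θ, Real.cos θ]

/-- The state matrix `A`: `m × m` blocks of size `2 × 2`, with `Q` on the block diagonal and the
identity `I₂` on the block superdiagonal. -/
def stateMatrix (m : ℕ) (θ : ℝ) : Matrix (Fin m × Fin 2) (Fin m × Fin 2) ℝ :=
  fun p q =>
    if q.1 = p.1 then rot θ p.2 q.2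
    else if (q.1 : ℕ) = (p.1 : ℕ) + 1 then (1 : Matrix (Fin 2) (Fin 2) ℝ) p.2 q.2
    else 0

/-- The gain `k_n`, `1 ≤ n ≤ 2m`. With `j = ⌈n / 2⌉` (that is, `n = 2j - 1` or `n = 2j`) it equals
`c_n ε^{m - j}` if `j ≤ m - 1`, and `c_n ε` if `j = m`. -/
def gain (m : ℕ) (c : ℕ → ℝ) (ε : ℝ) (n : ℕ) : ℝ :=
  if (n + 1) / 2 < m then c n * ε ^ (m - (n + 1) / 2) else c n * ε

/-- The matrix `K`: its last row is `[k_1, …, k_{2m}]`, all the other entries vanish. -/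
def gainMatrix (m : ℕ) (c : ℕ → ℝ) (ε : ℝ) : Matrix (Fin m × Fin 2) (Fin m × Fin 2) ℝ :=
  fun p q =>
    if (p.1 : ℕ) + 1 = m ∧ p.2 = 1 then gain m c ε (2 * (q.1 : ℕ) + (q.2 : ℕ) + 1) else 0

/-- The matrix `A - lam K`. -/
def closedLoop (m : ℕ) (θ lam : ℝ) (c : ℕ → ℝ) (ε : ℝ) :
    Matrix (Fin m × Fin 2) (Fin m × Fin 2) ℝ :=
  stateMatrix m θ - lam • gainMatrix m c ε

/-- The spectral radius of a real square matrix: the largest modulus of a complex eigenvalue. -/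
def specRadius {ι : Type*} [Fintype ι] [DecidableEq ι] (B : Matrix ι ι ℝ) : ℝ :=
  (spectralRadius ℂ (B.map (fun x : ℝ => (x : ℂ)))).toReal

/-- `R_m = 1/2 + (c_{2m-1} sin θ - c_{2m} cos θ) / 2`. -/
def Rconst (m : ℕ) (θ : ℝ) (c : ℕ → ℝ) : ℝ :=
  1 / 2 + 1 / 2 * (c (2 * m - 1) * Real.sin θ - c (2 * m) * Real.cos θ)

/-- `H = Re[(c_{2m-5} i - c_{2m-4}) / (c_{2m-3} i - c_{2m-2}) e^{-iθ}]`, used for `m ≥ 3` only. -/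
def Hconst (m : ℕ) (θ : ℝ) (c : ℕ → ℝ) : ℝ :=
  (((c (2 * m - 5) : ℂ) * Complex.I - (c (2 * m - 4) : ℂ)) /
      ((c (2 * m - 3) : ℂ) * Complex.I - (c (2 * m - 2) : ℂ)) *
    Complex.exp (-(Complex.I * (θ : ℂ)))).re

/-- The requirements on the constants `c_1, …, c_{2m}` (`m ≥ 2`), where for `m ≥ 3` the numbers
`ϑ_3, …, ϑ_m` are the `m - 2` distinct roots of
`∑_{j=1}^{m-1} (c_{2j} - c_{2j-1} i) ϑ^{j-1} = 0`. -/
structure GainChoice (m : ℕ) (θ lam : ℝ) (c : ℕ → ℝ) (ϑ : ℕ → ℂ) : Prop where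
  c_odd : c (2 * m - 3) = -Real.sin (2 * θ)
  c_even : c (2 * m - 2) = Real.cos (2 * θ)
  two : m = 2 → Rconst m θ c < 0
  neg : 3 ≤ m → lam * Rconst m θ c + Hconst m θ c < 0
  distinct : 3 ≤ m → Set.InjOn ϑ (Set.Icc 3 m)
  root : 3 ≤ m → ∀ n ∈ Finset.Icc 3 m,
    ∑ j ∈ Finset.Icc 1 (m - 1),
      ((c (2 * j) : ℂ) - (c (2 * j - 1) : ℂ) * Complex.I) * ϑ n ^ (j - 1) = 0
  root_neg : 3 ≤ m → ∀ n ∈ Finset.Icc 3 m,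
    (ϑ n * Complex.exp (-(Complex.I * (θ : ℂ)))).re < 0

/-- `∑_{n=3}^m |ϑ_n|^{j-1} / ∏_{3 ≤ k ≤ m, k ≠ n} |ϑ_k - ϑ_n|`. -/
def vandermondeSum (m : ℕ) (ϑ : ℕ → ℂ) (j : ℕ) : ℝ :=
  ∑ n ∈ Finset.Icc 3 m,
    ‖ϑ n‖ ^ (j - 1) / ∏ k ∈ (Finset.Icc 3 m).erase n, ‖ϑ k - ϑ n‖

/-- The constant `M_j`, `1 ≤ j ≤ m`. -/
def Mconst (m : ℕ) (lam : ℝ) (ϑ : ℕ → ℂ) (j : ℕ) : ℝ :=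
  if j + 3 ≤ m then 5 / (2 * lam) * vandermondeSum m ϑ j
  else if j + 2 = m then 5 / (2 * lam) * (vandermondeSum m ϑ j + 1)
  else if j + 1 = m then 3 / Real.sqrt (2 * lam)
  else 5 / 2

/-- The power of `ε` in the bound, `1 ≤ j ≤ m`: `ε^{j-(m-1)}` for `j ≤ m - 2`, and `ε^{(j-m)/2}`
for `j = m - 1, m`. -/
def epsPower (m : ℕ) (ε : ℝ) (j : ℕ) : ℝ :=
  if j + 2 ≤ m then ε ^ ((j : ℤ) - ((m : ℤ) - 1))
  else ε ^ (((j : ℝ) - (m : ℝ)) / 2)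

end Oscillator

end

namespace Oscillator

/-! For small `ε` the closed loop has `2m` distinct eigenvalues, `m` near `E = e^{iθ}` and their
conjugates. Expanding in left and right eigenvectors `l`, `v` gives `A_i^s ξ = ∑ z^s (l·ξ / l·v) v`,
and `|z| ≤ ρ_i`, so only the size of each weight `‖l·ξ‖ ‖v_p‖ / ‖l·v‖` matters
(`abs_pow_mulVec_le`).

With `u = (z - e^{iθ})⁻¹` and `U = (z - e^{-iθ})⁻¹` the eigenvectors are explicit: powers of `u`,
`U` on the right, Horner partial sums on the left, subject to one scalar characteristic equation in
`u`, `U`. Put `u = y/δ`. As `δ → 0` the equation becomes a polynomial in `y`, the terms in `U` being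
negligible, and each simple nonzero root continues to small `δ` by the implicit function theorem.

Two scalings occur. For `ε = δ` the roots used are the `1/ϑ_n`, giving `m - 2` eigenvalues with `z -
E ≈ ε ϑ_n`. For `ε = δ²` they are the two roots of `g y² + 2/λ = 0` with `|g| = 1`, giving two
eigenvalues at distance of order `√ε`. `exists_branch_bound` treats both at once and finds the limit
of the weights; `exists_slow_branch` and `exists_fast_branch` evaluate it. The limits lie strictly
below the constants `M_{ij}`, and this slack absorbs the errors
(`eventually_le_Mconst_mul_epsPower`). -/

/-! ### Spectral expansion of matrix powers. -/

theorem norm_le_specRadius {κ : Type*} [Fintype κ] [DecidableEq κ] (B : Matrix κ κ ℝ) (z : ℂ)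
    (v : κ → ℂ) (hv0 : v ≠ 0) (hv : B.map (fun x : ℝ => (x : ℂ)) *ᵥ v = z • v) :
    ‖z‖ ≤ specRadius B := by
  set M := B.map (fun x : ℝ => (x : ℂ)) with hM
  have hz : z ∈ spectrum ℂ M := by
    rw [← Matrix.spectrum_toLin']
    apply Module.End.HasEigenvalue.mem_spectrum
    apply Module.End.hasEigenvalue_of_hasEigenvector (x := v)
    rw [Module.End.hasEigenvector_iff]
    refine ⟨?_, hv0⟩
    rw [Module.End.mem_eigenspace_iff, Matrix.toLin'_apply, hv]
  have hfin : (spectrum ℂ M).Finite := Matrix.finite_spectrum M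
  have htop : spectralRadius ℂ M ≠ ⊤ := by
    obtain ⟨C, hC⟩ := (hfin.image (fun k : ℂ => ‖k‖₊)).bddAbove
    have : spectralRadius ℂ M ≤ (C : ENNReal) := by
      refine iSup₂_le fun k hk => ?_
      exact_mod_cast hC (Set.mem_image_of_mem _ hk)
    exact ne_top_of_le_ne_top ENNReal.coe_ne_top this
  have hle : (‖z‖₊ : ENNReal) ≤ spectralRadius ℂ M :=
    le_iSup₂ (f := fun (k : ℂ) (_ : k ∈ spectrum ℂ M) => (‖k‖₊ : ENNReal)) z hz
  have := ENNReal.toReal_mono htop hle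
  simpa [specRadius] using this

theorem pow_mulVec_eigenvector {κ : Type*} [Fintype κ] [DecidableEq κ] (M : Matrix κ κ ℂ)
    (z : ℂ) (v : κ → ℂ) (hv : M *ᵥ v = z • v) (s : ℕ) : M ^ s *ᵥ v = z ^ s • v := by
  induction s with
  | zero => simp
  | succ s ih => rw [pow_succ, ← Matrix.mulVec_mulVec, hv, Matrix.mulVec_smul, ih, smul_smul,
      pow_succ, mul_comm]

/-- Left and right eigenvectors for different eigenvalues are orthogonal, so the left ones, divided
by `l n ⬝ᵥ v n`, are the rows of the inverse of the matrix of right ones. No eigenvector matrix has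
to be inverted. -/
theorem pow_mulVec_eq_sum {κ τ : Type*} [Fintype κ] [DecidableEq κ] [Fintype τ] [DecidableEq τ]
    (hcard : Fintype.card τ = Fintype.card κ) (M : Matrix κ κ ℂ) (z : τ → ℂ) (v l : τ → κ → ℂ)
    (hv : ∀ n, M *ᵥ v n = z n • v n) (hl : ∀ n, l n ᵥ* M = z n • l n)
    (hne : ∀ n, l n ⬝ᵥ v n ≠ 0) (hz : Function.Injective z) (x : κ → ℂ) (s : ℕ) :
    M ^ s *ᵥ x = ∑ n, z n ^ s • ((l n ⬝ᵥ x / (l n ⬝ᵥ v n)) • v n) := by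
  have horth : ∀ n k, n ≠ k → l n ⬝ᵥ v k = 0 := by
    intro n k hnk
    have h1 : l n ⬝ᵥ (M *ᵥ v k) = (l n ᵥ* M) ⬝ᵥ v k := Matrix.dotProduct_mulVec _ _ _
    rw [hv, hl, dotProduct_smul, smul_dotProduct, smul_eq_mul, smul_eq_mul] at h1
    have h2 : (z k - z n) * (l n ⬝ᵥ v k) = 0 := by rw [sub_mul, h1, sub_self]
    rcases mul_eq_zero.1 h2 with h | h
    · exact absurd (hz (sub_eq_zero.1 h)).symm hnk
    · exact h
  let V : Matrix κ τ ℂ := Matrix.of fun p n => v n p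
  let Lm : Matrix τ κ ℂ := Matrix.of fun n p => l n p / (l n ⬝ᵥ v n)
  have hLV : Lm * V = 1 := by
    ext n k
    have : (Lm * V) n k = (l n ⬝ᵥ v k) / (l n ⬝ᵥ v n) := by
      simp only [Matrix.mul_apply, Lm, V, Matrix.of_apply, dotProduct, Finset.sum_div]
      exact Finset.sum_congr rfl fun _ _ => by ring
    rw [this, Matrix.one_apply]
    split_ifs with h
    · subst h; exact div_self (hne n)
    · rw [horth n k h, zero_div]
  have hVL : V * Lm = 1 := (Matrix.mul_eq_one_comm_of_card_eq _ _ _ hcard).1 hLV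
  have hx : x = ∑ n, (l n ⬝ᵥ x / (l n ⬝ᵥ v n)) • v n := by
    have h0 : V *ᵥ (Lm *ᵥ x) = x := by rw [Matrix.mulVec_mulVec, hVL, Matrix.one_mulVec]
    have h1 : ∀ n, (Lm *ᵥ x) n = l n ⬝ᵥ x / (l n ⬝ᵥ v n) := by
      intro n
      simp only [Matrix.mulVec, Lm, dotProduct, Matrix.of_apply, Finset.sum_div]
      exact Finset.sum_congr rfl fun _ _ => by ring
    funext p
    conv_lhs => rw [← h0]
    simp only [Matrix.mulVec, dotProduct, Finset.sum_apply, Pi.smul_apply, smul_eq_mul]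
    refine Finset.sum_congr rfl fun n _ => ?_
    have := h1 n
    simp only [Matrix.mulVec, dotProduct] at this
    rw [this]; simp [V, mul_comm]
  conv_lhs => rw [hx]
  rw [Matrix.mulVec_sum]
  refine Finset.sum_congr rfl fun n _ => ?_
  rw [Matrix.mulVec_smul, pow_mulVec_eigenvector M _ _ (hv n), smul_comm]

/-- Since `B` and `ξ` are real, conjugating an eigenvalue with its two eigenvectors gives another
such triple with a term of the same modulus: half of the spectrum suffices, whence the factor 2.
`hz'` keeps the two halves disjoint. -/
theorem abs_pow_mulVec_le {κ ι : Type*} [Fintype κ] [DecidableEq κ] [Fintype ι] [DecidableEq ι]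
    (hcard : Fintype.card κ = 2 * Fintype.card ι) (B : Matrix κ κ ℝ) (z : ι → ℂ) (v l : ι → κ → ℂ)
    (hv : ∀ n, B.map (fun x : ℝ => (x : ℂ)) *ᵥ v n = z n • v n)
    (hl : ∀ n, l n ᵥ* B.map (fun x : ℝ => (x : ℂ)) = z n • l n)
    (hne : ∀ n, l n ⬝ᵥ v n ≠ 0) (hz : Function.Injective z)
    (hz' : ∀ n k, z n ≠ starRingEnd ℂ (z k)) (ξ : κ → ℝ) (s : ℕ) (p : κ) :
    |(B ^ s *ᵥ ξ) p| ≤ specRadius B ^ s *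
      ∑ n, 2 * ‖l n ⬝ᵥ (fun q => (ξ q : ℂ))‖ * ‖v n p‖ / ‖l n ⬝ᵥ v n‖ := by
  set M := B.map (fun x : ℝ => (x : ℂ)) with hM
  set x : κ → ℂ := fun q => (ξ q : ℂ) with hx
  have hMe : ∀ p q, M p q = (B p q : ℂ) := fun _ _ => rfl
  have hreal : M ^ s *ᵥ x = fun q => ((B ^ s *ᵥ ξ) q : ℂ) := by
    have h1 : M ^ s = (B ^ s).map (fun x : ℝ => (x : ℂ)) :=
      ((Complex.ofRealHom.mapMatrix).map_pow B s).symm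
    rw [h1]
    funext q
    simp [Matrix.mulVec, dotProduct, hx]
  have hconj : ∀ a b : κ → ℂ, (fun q => starRingEnd ℂ (a q)) ⬝ᵥ (fun q => starRingEnd ℂ (b q)) =
      starRingEnd ℂ (a ⬝ᵥ b) := by
    intro a b; simp [dotProduct]
  have hxc : (fun q => starRingEnd ℂ (x q)) = x := by funext q; simp [hx]
  have hsum := pow_mulVec_eq_sum (τ := ι ⊕ ι) (by simp [hcard, two_mul]) M
    (Sum.elim z fun n => starRingEnd ℂ (z n))
    (Sum.elim v fun n q => starRingEnd ℂ (v n q)) (Sum.elim l fun n q => starRingEnd ℂ (l n q))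
    (by
      rintro (n | n)
      · exact hv n
      · funext q
        have := congrArg (starRingEnd ℂ) (congrFun (hv n) q)
        simp only [Matrix.mulVec, dotProduct, map_sum, map_mul, Pi.smul_apply, smul_eq_mul, hMe,
          Complex.conj_ofReal] at this
        simpa [Matrix.mulVec, dotProduct, hMe] using this)
    (by
      rintro (n | n)
      · exact hl n
      · funext q
        have := congrArg (starRingEnd ℂ) (congrFun (hl n) q)
        simp only [Matrix.vecMul, dotProduct, map_sum, map_mul, Pi.smul_apply, smul_eq_mul, hMe,
          Complex.conj_ofReal] at this
        simpa [Matrix.vecMul, dotProduct, hMe] using this)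
    (by
      rintro (n | n)
      · exact hne n
      · simpa [hconj] using hne n)
    (by
      rintro (n | n) (k | k) h
      · exact congrArg _ (hz h)
      · exact absurd h (hz' n k)
      · exact absurd h.symm (hz' k n)
      · exact congrArg _ (hz ((starRingEnd ℂ).injective h)))
    x s
  have hzle : ∀ n, ‖z n‖ ^ s ≤ specRadius B ^ s := by
    intro n
    refine pow_le_pow_left₀ (norm_nonneg _) (norm_le_specRadius B (z n) (v n) ?_ (hv n)) s
    rintro h
    exact hne n (by rw [h, dotProduct_zero])
  rw [hreal, Fintype.sum_sum_type] at hsum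
  have hval : (((B ^ s *ᵥ ξ) p : ℝ) : ℂ) = _ := congrFun hsum p
  have h1 : |(B ^ s *ᵥ ξ) p| = ‖(((B ^ s *ᵥ ξ) p : ℝ) : ℂ)‖ := by simp
  rw [h1, hval]
  simp only [Sum.elim_inl, Sum.elim_inr, Pi.add_apply, Finset.sum_apply, Pi.smul_apply,
    smul_eq_mul]
  have hlx : ∀ n, (fun q => starRingEnd ℂ (l n q)) ⬝ᵥ x = starRingEnd ℂ (l n ⬝ᵥ x) := by
    intro n; rw [← hconj, hxc]
  have hterm : ∀ n, ‖z n ^ s * (l n ⬝ᵥ x / (l n ⬝ᵥ v n) * v n p)‖ ≤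
      specRadius B ^ s * (‖l n ⬝ᵥ x‖ * ‖v n p‖ / ‖l n ⬝ᵥ v n‖) := by
    intro n
    rw [norm_mul, norm_mul, norm_div, norm_pow, div_mul_eq_mul_div]
    exact mul_le_mul_of_nonneg_right (hzle n) (by positivity)
  rw [Finset.mul_sum]
  calc _ ≤ ∑ n, specRadius B ^ s * (‖l n ⬝ᵥ x‖ * ‖v n p‖ / ‖l n ⬝ᵥ v n‖) +
        ∑ n, specRadius B ^ s * (‖l n ⬝ᵥ x‖ * ‖v n p‖ / ‖l n ⬝ᵥ v n‖) := by
        refine (norm_add_le _ _).trans (add_le_add ?_ ?_)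
        · exact (norm_sum_le _ _).trans (Finset.sum_le_sum fun n _ => hterm n)
        · refine (norm_sum_le _ _).trans (Finset.sum_le_sum fun n _ => ?_)
          rw [hlx, hconj, ← map_div₀, ← map_pow, ← map_mul, ← map_mul, Complex.norm_conj]
          exact hterm n
    _ = _ := by
        rw [← Finset.sum_add_distrib]
        exact Finset.sum_congr rfl fun n _ => by ring

end Oscillator

/-! ### Explicit eigenvectors of the closed loop. -/

noncomputable section

namespace Oscillator

/-- The sum `∑_{j < l} h_j u^{l-j}`, defined by recursion on `l`. -/
def hornerSum (u : ℂ) (h : ℕ → ℂ) : ℕ → ℂ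
  | 0 => 0
  | l + 1 => u * (hornerSum u h l + h l)

theorem hornerSum_eq (u : ℂ) (h : ℕ → ℂ) (m : ℕ) :
    hornerSum u h m = ∑ j ∈ Finset.range m, h j * u ^ (m - j) := by
  induction m with
  | zero => simp [hornerSum]
  | succ m ih =>
    rw [hornerSum, ih, Finset.sum_range_succ, mul_add, Finset.mul_sum]
    congr 1
    · refine Finset.sum_congr rfl fun j hj => ?_
      rw [Nat.succ_sub (Finset.mem_range.1 hj).le, pow_succ]; ring
    · simp [mul_comm]

/-- In the double sum, `h j` contributes the same power `u ^ (m - j + 1)` for each of the `m - j`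
indices `l` with `j ≤ l < m`. -/
theorem sum_hornerSum_mul_pow (u : ℂ) (h : ℕ → ℂ) (m : ℕ) :
    ∑ l ∈ Finset.range m, hornerSum u h (l + 1) * u ^ (m - l) =
      ∑ j ∈ Finset.range m, ((m - j : ℕ) : ℂ) * (h j * u ^ (m - j + 1)) := by
  induction m with
  | zero => simp
  | succ m ih =>
    have h1 : ∑ l ∈ Finset.range (m + 1), hornerSum u h (l + 1) * u ^ (m + 1 - l) =
        u * ∑ l ∈ Finset.range m, hornerSum u h (l + 1) * u ^ (m - l) +
          u * hornerSum u h (m + 1) := by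
      rw [Finset.sum_range_succ, Finset.mul_sum]
      congr 1
      · refine Finset.sum_congr rfl fun j hj => ?_
        rw [Nat.succ_sub (Finset.mem_range.1 hj).le, pow_succ]; ring
      · simp [mul_comm]
    rw [h1, ih, hornerSum_eq, Finset.mul_sum, Finset.mul_sum, Finset.sum_range_succ,
      Finset.sum_range_succ _ m, ← add_assoc, ← Finset.sum_add_distrib]
    congr 1
    · refine Finset.sum_congr rfl fun j hj => ?_
      rw [Nat.succ_sub (Finset.mem_range.1 hj).le, pow_succ, pow_succ]; push_cast; ring
    · simp; ring

theorem sum_fin_ite_eq (m a : ℕ) (f : ℕ → ℂ) :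
    ∑ i : Fin m, (if (i : ℕ) = a then f i else 0) = if a < m then f a else 0 := by
  rw [Fin.sum_univ_eq_sum_range (fun i => if i = a then f i else 0), Finset.sum_ite_eq']
  simp

/-- The weight of the gains `k_{2j+1}`, `k_{2j+2}`, a power of `ε`. -/
def gainWeight (m : ℕ) (ε : ℝ) (j : ℕ) : ℝ := if j + 1 < m then ε ^ (m - 1 - j) else ε

/-- The complex gain `c_{2j+2} - c_{2j+1} i`. -/
def cplxGain (c : ℕ → ℝ) (j : ℕ) : ℂ := (c (2 * j + 2) : ℂ) - (c (2 * j + 1) : ℂ) * Complex.I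

theorem gain_odd (m : ℕ) (c : ℕ → ℝ) (ε : ℝ) (j : ℕ) :
    gain m c ε (2 * j + 1) = c (2 * j + 1) * gainWeight m ε j := by
  have h : (2 * j + 1 + 1) / 2 = j + 1 := by omega
  have h' : m - (j + 1) = m - 1 - j := by omega
  simp only [gain, gainWeight, h, h']
  split_ifs <;> rfl

theorem gain_even (m : ℕ) (c : ℕ → ℝ) (ε : ℝ) (j : ℕ) :
    gain m c ε (2 * j + 2) = c (2 * j + 2) * gainWeight m ε j := by
  have h : (2 * j + 2 + 1) / 2 = j + 1 := by omega
  have h' : m - (j + 1) = m - 1 - j := by omega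
  simp only [gain, gainWeight, h, h']
  split_ifs <;> rfl

theorem gain_even' (m : ℕ) (c : ℕ → ℝ) (ε : ℝ) (j : ℕ) :
    gain m c ε (2 * j + 1 + 1) = c (2 * j + 2) * gainWeight m ε j := gain_even m c ε j

theorem closedLoop_apply (m : ℕ) (θ lam : ℝ) (c : ℕ → ℝ) (ε : ℝ) (p q : Fin m × Fin 2) :
    closedLoop m θ lam c ε p q = (if (q.1 : ℕ) = p.1 then rot θ p.2 q.2 else 0) +
      (if (q.1 : ℕ) = (p.1 : ℕ) + 1 then (if p.2 = q.2 then 1 else 0) else 0) -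
      lam * (if (p.1 : ℕ) + 1 = m ∧ p.2 = 1 then
        gain m c ε (2 * (q.1 : ℕ) + (q.2 : ℕ) + 1) else 0) := by
  simp only [closedLoop, Matrix.sub_apply, Matrix.smul_apply, smul_eq_mul, gainMatrix, stateMatrix,
    Fin.ext_iff (a := q.1)]
  congr 1
  by_cases h : (q.1 : ℕ) = p.1
  · have : ¬ ((q.1 : ℕ) = (p.1 : ℕ) + 1) := by omega
    simp [h]
  · simp [h, Matrix.one_apply]

/-- Coordinates of the right eigenvector attached to `u = (z - e^{iθ})⁻¹`, `U = (z - e^{-iθ})⁻¹`. -/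
def rightVec (m : ℕ) (u U : ℂ) (j : ℕ) (e : Fin 2) : ℂ :=
  if e = 0 then -(Complex.I / 2 * (u ^ (m - j) - U ^ (m - j))) else (u ^ (m - j) + U ^ (m - j)) / 2

/-- Coordinates of the left eigenvector attached to `u = (z - e^{iθ})⁻¹`, `U = (z - e^{-iθ})⁻¹`. -/
def leftVec (u U : ℂ) (h h' : ℕ → ℂ) (j : ℕ) (e : Fin 2) : ℂ :=
  if e = 0 then Complex.I / 2 * (hornerSum u h (j + 1) - hornerSum U h' (j + 1))
  else (hornerSum u h (j + 1) + hornerSum U h' (j + 1)) / 2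

/-- The combinations `y ± i x` diagonalise the rotation block; in them the left vector splits into
its `u` part and its `U` part. -/
theorem leftVec_dotProduct (m : ℕ) (u U : ℂ) (h h' x y : ℕ → ℂ) :
    (fun p : Fin m × Fin 2 => leftVec u U h h' p.1 p.2) ⬝ᵥ
      (fun p : Fin m × Fin 2 => if p.2 = 0 then x p.1 else y p.1) =
    1 / 2 * ∑ l ∈ Finset.range m, (hornerSum u h (l + 1) * (y l + Complex.I * x l) +
      hornerSum U h' (l + 1) * (y l - Complex.I * x l)) := by
  rw [dotProduct, Fintype.sum_prod_type, Finset.mul_sum]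
  simp only [Fin.sum_univ_two, leftVec]
  rw [← Fin.sum_univ_eq_sum_range (fun l => 1 / 2 *
    (hornerSum u h (l + 1) * (y l + Complex.I * x l) +
      hornerSum U h' (l + 1) * (y l - Complex.I * x l)))]
  refine Finset.sum_congr rfl fun l _ => ?_
  simp only [if_true, one_ne_zero, if_false]
  ring

/-- As `du/dz = -u²`, the right side is `-1/2` times the `z`-derivative of the characteristic
function `∑ (h j * u ^ (m - j) + h' j * U ^ (m - j))`. Thus `l·v ≠ 0` expresses that the eigenvalue
is a simple root. -/
theorem leftVec_dotProduct_rightVec (m : ℕ) (u U : ℂ) (h h' : ℕ → ℂ) :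
    (fun p : Fin m × Fin 2 => leftVec u U h h' p.1 p.2) ⬝ᵥ
      (fun p => rightVec m u U p.1 p.2) =
    1 / 2 * ∑ j ∈ Finset.range m, ((m - j : ℕ) : ℂ) *
      (h j * u ^ (m - j + 1) + h' j * U ^ (m - j + 1)) := by
  have := leftVec_dotProduct m u U h h' (fun j => -(Complex.I / 2 * (u ^ (m - j) - U ^ (m - j))))
    (fun j => (u ^ (m - j) + U ^ (m - j)) / 2)
  simp only [rightVec]
  rw [this]
  congr 1
  have e : ∑ j ∈ Finset.range m, ((m - j : ℕ) : ℂ) *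
      (h j * u ^ (m - j + 1) + h' j * U ^ (m - j + 1)) =
      ∑ l ∈ Finset.range m, (hornerSum u h (l + 1) * u ^ (m - l) +
        hornerSum U h' (l + 1) * U ^ (m - l)) := by
    rw [Finset.sum_add_distrib, sum_hornerSum_mul_pow, sum_hornerSum_mul_pow,
      ← Finset.sum_add_distrib]
    exact Finset.sum_congr rfl fun _ _ => mul_add _ _ _
  rw [e]
  refine Finset.sum_congr rfl fun l _ => ?_
  linear_combination (-1 / 2 * hornerSum u h (l + 1) * (u ^ (m - l) - U ^ (m - l)) +
    1 / 2 * hornerSum U h' (l + 1) * (u ^ (m - l) - U ^ (m - l))) * Complex.I_sq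

theorem exp_mul_I_eq (θ : ℝ) :
    Complex.exp (θ * Complex.I) = Complex.cos θ + Complex.sin θ * Complex.I :=
  Complex.exp_mul_I _

theorem exp_neg_mul_I_eq (θ : ℝ) :
    Complex.exp (-θ * Complex.I) = Complex.cos θ - Complex.sin θ * Complex.I := by
  rw [Complex.exp_mul_I, Complex.cos_neg, Complex.sin_neg]; ring

section Eigen

variable {m : ℕ} {θ lam : ℝ} {c : ℕ → ℝ} {ε : ℝ} {z u U : ℂ}

/-- In the coordinates `y ± i x` the Jordan rows say that each block is `u` (resp. `U`) times the
next, hence the powers. The last row needs the gains to pair with the vector to `-1/λ`, which is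
`heq`. -/
theorem closedLoop_mulVec_rightVec (hlam : lam ≠ 0)
    (hu : u * (z - Complex.exp (θ * Complex.I)) = 1)
    (hU : U * (z - Complex.exp (-θ * Complex.I)) = 1)
    (heq : 2 / (lam : ℂ) + ∑ j ∈ Finset.range m, gainWeight m ε j * (cplxGain c j * u ^ (m - j) +
      starRingEnd ℂ (cplxGain c j) * U ^ (m - j)) = 0) :
    (closedLoop m θ lam c ε).map (fun x : ℝ => (x : ℂ)) *ᵥ
      (fun p => rightVec m u U p.1 p.2) = z • (fun p => rightVec m u U p.1 p.2) := by
  have hgain : ∑ j : Fin m, ((gain m c ε (2 * j + 1) : ℂ) * rightVec m u U j 0 +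
      (gain m c ε (2 * j + 2) : ℂ) * rightVec m u U j 1) = -1 / lam := by
    have hl : (lam : ℂ) ≠ 0 := by exact_mod_cast hlam
    rw [Fin.sum_univ_eq_sum_range (fun j => ((gain m c ε (2 * j + 1) : ℂ) * rightVec m u U j 0 +
      (gain m c ε (2 * j + 2) : ℂ) * rightVec m u U j 1))]
    have : ∑ j ∈ Finset.range m, ((gain m c ε (2 * j + 1) : ℂ) * rightVec m u U j 0 +
        (gain m c ε (2 * j + 2) : ℂ) * rightVec m u U j 1) =
        1 / 2 * ∑ j ∈ Finset.range m, gainWeight m ε j * (cplxGain c j * u ^ (m - j) +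
      starRingEnd ℂ (cplxGain c j) * U ^ (m - j)) := by
      rw [Finset.mul_sum]
      refine Finset.sum_congr rfl fun j _ => ?_
      rw [gain_odd, gain_even]
      simp only [rightVec, cplxGain, if_true, one_ne_zero, if_false, map_sub, map_mul,
        Complex.conj_ofReal, Complex.conj_I]
      push_cast
      ring
    rw [this, eq_neg_of_add_eq_zero_right heq]
    field_simp
  funext p
  obtain ⟨i, e⟩ := p
  have hsplit : ((closedLoop m θ lam c ε).map (fun x : ℝ => (x : ℂ)) *ᵥ
      (fun p => rightVec m u U p.1 p.2)) (i, e) =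
      ((rot θ e 0 : ℂ) * rightVec m u U i 0 + (rot θ e 1 : ℂ) * rightVec m u U i 1) +
      (if (i : ℕ) + 1 < m then rightVec m u U (i + 1) e else 0) -
      lam * (if (i : ℕ) + 1 = m ∧ e = 1 then (-1 / lam : ℂ) else 0) := by
    have h1 : ∑ j : Fin m, (if (j : ℕ) = i then ((rot θ e 0 : ℂ) * rightVec m u U j 0 +
        (rot θ e 1 : ℂ) * rightVec m u U j 1) else 0) =
        ((rot θ e 0 : ℂ) * rightVec m u U i 0 + (rot θ e 1 : ℂ) * rightVec m u U i 1) := by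
      rw [sum_fin_ite_eq m i (fun j => (rot θ e 0 : ℂ) * rightVec m u U j 0 +
        (rot θ e 1 : ℂ) * rightVec m u U j 1), if_pos i.2]
    have h2 : ∑ j : Fin m, (if (j : ℕ) = i + 1 then rightVec m u U j e else 0) =
        (if (i : ℕ) + 1 < m then rightVec m u U (i + 1) e else 0) :=
      sum_fin_ite_eq m (i + 1) (fun j => rightVec m u U j e)
    rw [← h1, ← h2, ← hgain, Matrix.mulVec, dotProduct, Fintype.sum_prod_type]
    have h3 : (lam : ℂ) * (if (i : ℕ) + 1 = m ∧ e = 1 then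
        ∑ j : Fin m, ((gain m c ε (2 * j + 1) : ℂ) * rightVec m u U j 0 +
          (gain m c ε (2 * j + 2) : ℂ) * rightVec m u U j 1) else 0) =
        ∑ j : Fin m, (lam : ℂ) * (if (i : ℕ) + 1 = m ∧ e = 1 then
          ((gain m c ε (2 * j + 1) : ℂ) * rightVec m u U j 0 +
          (gain m c ε (2 * j + 2) : ℂ) * rightVec m u U j 1) else 0) := by
      split_ifs
      · rw [Finset.mul_sum]
      · simp
    rw [h3, ← Finset.sum_add_distrib, ← Finset.sum_sub_distrib]
    refine Finset.sum_congr rfl fun j _ => ?_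
    simp only [Fin.sum_univ_two, Matrix.map_apply, closedLoop_apply]
    fin_cases e <;> simp <;> split_ifs <;> push_cast <;> ring
  have hl : (lam : ℂ) ≠ 0 := by exact_mod_cast hlam
  -- At the fictitious index `m` the formula gives `(0, 1)`, exactly the feedback contribution in
  -- the last block, so the last row needs no separate treatment.
  have htail : (if (i : ℕ) + 1 < m then rightVec m u U (i + 1) e else 0) -
      lam * (if (i : ℕ) + 1 = m ∧ e = 1 then (-1 / lam : ℂ) else 0) =
      rightVec m u U (i + 1) e := by
    by_cases him : (i : ℕ) + 1 < m
    · simp [him, him.ne]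
    · have him' : (i : ℕ) + 1 = m := by omega
      fin_cases e
      · simp [him', rightVec]
      · simp [him', rightVec]
        field_simp
  rw [hsplit, add_sub_assoc, htail, Pi.smul_apply, smul_eq_mul]
  rw [exp_mul_I_eq] at hu
  rw [exp_neg_mul_I_eq] at hU
  have hmi : m - (i : ℕ) = (m - (i + 1)) + 1 := by omega
  fin_cases e
  · simp only [rightVec, rot, hmi, pow_succ]
    simp
    linear_combination Complex.I / 2 * u ^ (m - (i + 1)) * hu -
      Complex.I / 2 * U ^ (m - (i + 1)) * hU + Complex.sin θ / 2 *
        (u ^ (m - (i + 1)) * u + U ^ (m - (i + 1)) * U) * Complex.I_sq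
  · simp only [rightVec, rot, hmi, pow_succ]
    simp
    linear_combination -(1 / 2 * u ^ (m - (i + 1)) * hu) - 1 / 2 * U ^ (m - (i + 1)) * hU

/-- Column by column the equation is the Horner recursion `(z - e^{iθ}) W_{l+1} = W_l + h_l` and its
conjugate analogue, once the last coordinate is normalised to `-1/λ`; `heq` says that the recursion
ends at this value. -/
theorem leftVec_vecMul_closedLoop (hlam : lam ≠ 0)
    (hu : u * (z - Complex.exp (θ * Complex.I)) = 1)
    (hU : U * (z - Complex.exp (-θ * Complex.I)) = 1) {h h' : ℕ → ℂ}
    (hh : ∀ j, h j = gainWeight m ε j * cplxGain c j)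
    (hh' : ∀ j, h' j = gainWeight m ε j * starRingEnd ℂ (cplxGain c j))
    (heq : 2 / (lam : ℂ) + (hornerSum u h m + hornerSum U h' m) = 0) :
    (fun p : Fin m × Fin 2 => leftVec u U h h' p.1 p.2) ᵥ*
      (closedLoop m θ lam c ε).map (fun x : ℝ => (x : ℂ)) =
      z • (fun p : Fin m × Fin 2 => leftVec u U h h' p.1 p.2) := by
  have hl : (lam : ℂ) ≠ 0 := by exact_mod_cast hlam
  funext q
  obtain ⟨l, f⟩ := q
  have hsplit : ((fun p : Fin m × Fin 2 => leftVec u U h h' p.1 p.2) ᵥ*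
      (closedLoop m θ lam c ε).map (fun x : ℝ => (x : ℂ))) (l, f) =
      (leftVec u U h h' l 0 * (rot θ 0 f : ℂ) + leftVec u U h h' l 1 * (rot θ 1 f : ℂ)) +
      (if 1 ≤ (l : ℕ) then leftVec u U h h' (l - 1) f else 0) -
      lam * leftVec u U h h' (m - 1) 1 * gain m c ε (2 * (l : ℕ) + f + 1) := by
    have h1 : ∑ i : Fin m, (if (i : ℕ) = l then
        (leftVec u U h h' i 0 * (rot θ 0 f : ℂ) + leftVec u U h h' i 1 * (rot θ 1 f : ℂ)) else 0) =
        (leftVec u U h h' l 0 * (rot θ 0 f : ℂ) + leftVec u U h h' l 1 * (rot θ 1 f : ℂ)) := by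
      rw [sum_fin_ite_eq m l (fun i => leftVec u U h h' i 0 * (rot θ 0 f : ℂ) +
        leftVec u U h h' i 1 * (rot θ 1 f : ℂ)), if_pos l.2]
    have h2 : ∑ i : Fin m, (if (l : ℕ) = i + 1 then leftVec u U h h' i f else 0) =
        (if 1 ≤ (l : ℕ) then leftVec u U h h' (l - 1) f else 0) := by
      split_ifs with hl1
      · rw [← if_pos (c := (l : ℕ) - 1 < m) (t := leftVec u U h h' (l - 1) f) (e := 0) (by omega),
          ← sum_fin_ite_eq m (l - 1) (fun i => leftVec u U h h' i f)]
        refine Finset.sum_congr rfl fun i _ => if_congr (by omega) rfl rfl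
      · exact Finset.sum_eq_zero fun i _ => if_neg (by omega)
    have h3 : ∑ i : Fin m, (if (i : ℕ) = m - 1 then
        lam * leftVec u U h h' i 1 * gain m c ε (2 * (l : ℕ) + f + 1) else 0) =
        lam * leftVec u U h h' (m - 1) 1 * gain m c ε (2 * (l : ℕ) + f + 1) := by
      rw [sum_fin_ite_eq m (m - 1)
        (fun i => lam * leftVec u U h h' i 1 * gain m c ε (2 * (l : ℕ) + f + 1)),
        if_pos (by have := l.2; omega)]
    rw [← h1, ← h2, ← h3, Matrix.vecMul, dotProduct, Fintype.sum_prod_type,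
      ← Finset.sum_add_distrib, ← Finset.sum_sub_distrib]
    refine Finset.sum_congr rfl fun i _ => ?_
    have e1 : ((i : ℕ) = m - 1) ↔ ((i : ℕ) + 1 = m) := by have := i.2; omega
    simp only [Fin.sum_univ_two, Matrix.map_apply, closedLoop_apply, eq_comm (a := (l : ℕ)) (b := i),
      e1]
    fin_cases f <;> simp <;> split_ifs <;> push_cast <;> ring
  have hlast : lam * leftVec u U h h' (m - 1) 1 = -1 := by
    have hm : m - 1 + 1 = m := by have := l.2; omega
    simp only [leftVec, hm, one_ne_zero, if_false]
    rw [eq_neg_of_add_eq_zero_right heq]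
    field_simp
  have hprev : (if 1 ≤ (l : ℕ) then leftVec u U h h' (l - 1) f else 0) =
      if f = 0 then Complex.I / 2 * (hornerSum u h l - hornerSum U h' l)
      else (hornerSum u h l + hornerSum U h' l) / 2 := by
    split_ifs with hl1 hf hf
    · simp [leftVec, hf, Nat.sub_add_cancel hl1]
    · simp [leftVec, hf, Nat.sub_add_cancel hl1]
    · have : (l : ℕ) = 0 := by omega
      simp [this, hornerSum]
    · have : (l : ℕ) = 0 := by omega
      simp [this, hornerSum]
  rw [hsplit, hlast, hprev, Pi.smul_apply, smul_eq_mul]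
  rw [exp_mul_I_eq] at hu
  rw [exp_neg_mul_I_eq] at hU
  fin_cases f
  · simp only [leftVec, rot, hornerSum, hh, hh']
    simp [gain_odd, cplxGain]
    set X := hornerSum u h l
    set Y := hornerSum U h' l
    set k : ℂ := (gainWeight m ε l : ℂ)
    set c1 : ℂ := (c (2 * l + 1) : ℂ)
    set c2 : ℂ := (c (2 * l + 2) : ℂ)
    linear_combination -(Complex.I / 2) * (X + k * (c2 - c1 * Complex.I)) * hu +
      Complex.I / 2 * (Y + k * (c2 + c1 * Complex.I)) * hU +
      (k * c1 - Complex.sin θ / 2 * (u * (X + k * (c2 - c1 * Complex.I)) +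
        U * (Y + k * (c2 + c1 * Complex.I)))) * Complex.I_sq
  · simp only [leftVec, rot, hornerSum, hh, hh']
    simp [gain_even', cplxGain]
    set X := hornerSum u h l
    set Y := hornerSum U h' l
    set k : ℂ := (gainWeight m ε l : ℂ)
    set c1 : ℂ := (c (2 * l + 1) : ℂ)
    set c2 : ℂ := (c (2 * l + 2) : ℂ)
    linear_combination -(1 / 2) * (X + k * (c2 - c1 * Complex.I)) * hu -
      1 / 2 * (Y + k * (c2 + c1 * Complex.I)) * hU

end Eigen

/-! ### Continuation of simple roots. -/

open Filter Topology

theorem exists_implicit_branch {f : ℂ × ℂ → ℂ} {y₀ s : ℂ} (hf : ContDiffAt ℂ 1 f (0, y₀))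
    (h0 : f (0, y₀) = 0) (hs : HasDerivAt (fun y => f (0, y)) s y₀) (hs0 : s ≠ 0) :
    ∃ y : ℂ → ℂ, Tendsto y (𝓝 0) (𝓝 y₀) ∧ ∀ᶠ x in 𝓝 0, f (x, y x) = 0 := by
  have hstrict := hf.hasStrictFDerivAt one_ne_zero
  have hcomp : HasFDerivAt (fun y => f (0, y))
      ((fderiv ℂ f (0, y₀)).comp (ContinuousLinearMap.inr ℂ ℂ ℂ)) y₀ :=
    HasFDerivAt.comp y₀ hstrict.hasFDerivAt (hasFDerivAt_prodMk_right 0 y₀)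
  have heq := hcomp.unique hs.hasFDerivAt
  have hinv : ((fderiv ℂ f (0, y₀)).comp (ContinuousLinearMap.inr ℂ ℂ ℂ)).IsInvertible := by
    refine ⟨ContinuousLinearEquiv.unitsEquivAut ℂ (Units.mk0 s hs0), ?_⟩
    rw [heq]
    ext
    simp
  refine ⟨hstrict.implicitFunctionOfProdDomain hinv,
    hstrict.tendsto_implicitFunctionOfProdDomain hinv, ?_⟩
  have := hstrict.eventually_apply_implicitFunctionOfProdDomain hinv
  rwa [h0] at this

/-- At `x = 0` the second sum disappears because `k j ≠ 0`, leaving a polynomial in `y`. The number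
in `hS` is `y₀ ^ 2` times its derivative at `y₀`; this form reappears as the limit of the rescaled
`l·v`. The factor `y (d y + x)⁻¹` is `U` written in terms of `y`. -/
theorem exists_perturbed_root (m : ℕ) (g g' : ℕ → ℂ) (e k a : ℕ → ℕ) (t : ℕ) (μ d y₀ : ℂ)
    (hd : d ≠ 0) (hy₀ : y₀ ≠ 0) (hk : ∀ j, k j ≠ 0)
    (hroot : ∑ j ∈ Finset.range m, g j * 0 ^ e j * y₀ ^ a j + 0 ^ t * μ = 0)
    (hS : ∑ j ∈ Finset.range m, (a j : ℂ) * (g j * 0 ^ e j * y₀ ^ (a j + 1)) ≠ 0) :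
    ∃ y : ℂ → ℂ, Tendsto y (𝓝 0) (𝓝 y₀) ∧ ∀ᶠ x in 𝓝 0,
      ∑ j ∈ Finset.range m, g j * x ^ e j * y x ^ a j + x ^ t * (μ +
        ∑ j ∈ Finset.range m, x ^ k j * (g' j * (y x * (d * y x + x)⁻¹) ^ a j)) = 0 := by
  let f : ℂ × ℂ → ℂ := fun p => ∑ j ∈ Finset.range m, g j * p.1 ^ e j * p.2 ^ a j +
    p.1 ^ t * (μ + ∑ j ∈ Finset.range m,
      p.1 ^ k j * (g' j * (p.2 * (d * p.2 + p.1)⁻¹) ^ a j))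
  have hf0 : ∀ y, f (0, y) = ∑ j ∈ Finset.range m, g j * 0 ^ e j * y ^ a j + 0 ^ t * μ := by
    intro y
    simp [f, hk]
  refine exists_implicit_branch (f := f)
    (s := ∑ j ∈ Finset.range m, g j * 0 ^ e j * (a j * y₀ ^ (a j - 1))) ?_ ?_ ?_ ?_
  · have hne : (d * ((0 : ℂ), y₀).2 + ((0 : ℂ), y₀).1) ≠ 0 := by simp [hd, hy₀]
    have hinv : ContDiffAt ℂ 1 (fun p : ℂ × ℂ => (d * p.2 + p.1)⁻¹) (0, y₀) :=
      ContDiffAt.inv (by fun_prop) hne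
    simp only [f]
    refine ContDiffAt.add (ContDiffAt.sum fun j _ => by fun_prop) ?_
    refine ContDiffAt.mul (by fun_prop) (ContDiffAt.add (by fun_prop)
      (ContDiffAt.sum fun j _ => ?_))
    exact ContDiffAt.mul (by fun_prop) (ContDiffAt.mul (by fun_prop)
      ((ContDiffAt.mul (by fun_prop) hinv).pow _))
  · rw [hf0, hroot]
  · simp only [hf0]
    refine HasDerivAt.add_const _ (HasDerivAt.fun_sum fun j _ => ?_)
    exact (hasDerivAt_pow _ _).const_mul _
  · intro h
    apply hS
    have : ∑ j ∈ Finset.range m, (a j : ℂ) * (g j * 0 ^ e j * y₀ ^ (a j + 1)) =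
        y₀ ^ 2 * ∑ j ∈ Finset.range m, g j * 0 ^ e j * (a j * y₀ ^ (a j - 1)) := by
      rw [Finset.mul_sum]
      refine Finset.sum_congr rfl fun j _ => ?_
      rcases Nat.eq_zero_or_pos (a j) with h0 | h0
      · simp [h0]
      · obtain ⟨b, hb⟩ := Nat.exists_eq_add_of_le' h0
        rw [hb, Nat.add_sub_cancel]
        ring
    rw [this, h, mul_zero]

/-! ### Norms and limits of the eigenvectors. -/

/-- The exponent of `ε` in the gains `k_{2j+1}`, `k_{2j+2}`. -/
def gainExp (m j : ℕ) : ℕ := if j + 1 < m then m - 1 - j else 1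

theorem gainExp_ne_zero (m j : ℕ) : gainExp m j ≠ 0 := by
  unfold gainExp; split_ifs <;> omega

theorem gainWeight_eq (m : ℕ) (ε : ℝ) (j : ℕ) : gainWeight m ε j = ε ^ gainExp m j := by
  unfold gainWeight gainExp; split_ifs <;> simp

theorem norm_rightVec_le (m : ℕ) (u U : ℂ) (j : ℕ) (e : Fin 2) :
    ‖rightVec m u U j e‖ ≤ 1 / 2 * (‖u‖ ^ (m - j) + ‖U‖ ^ (m - j)) := by
  unfold rightVec
  split_ifs
  · rw [norm_neg, norm_mul, norm_div, Complex.norm_I, ← norm_pow, ← norm_pow]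
    have := norm_sub_le (u ^ (m - j)) (U ^ (m - j))
    simp only [RCLike.norm_ofNat]
    linarith
  · rw [norm_div, ← norm_pow, ← norm_pow]
    have := norm_add_le (u ^ (m - j)) (U ^ (m - j))
    simp only [RCLike.norm_ofNat]
    linarith

/-- For real `x`, `y` the modulus of `y ± i x` is the Euclidean norm of one block of `ξ`, hence at
most `‖ξ‖`. -/
theorem norm_leftVec_dotProduct_le (m : ℕ) (u U : ℂ) (h h' : ℕ → ℂ)
    (ξ : EuclideanSpace ℝ (Fin m × Fin 2)) :
    ‖(fun p : Fin m × Fin 2 => leftVec u U h h' p.1 p.2) ⬝ᵥ (fun q => (ξ.ofLp q : ℂ))‖ ≤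
      1 / 2 * (‖ξ‖ * ∑ l ∈ Finset.range m,
        (‖hornerSum u h (l + 1)‖ + ‖hornerSum U h' (l + 1)‖)) := by
  let x : ℕ → ℂ := fun l => if hl : l < m then ((ξ (⟨l, hl⟩, 0) : ℝ) : ℂ) else 0
  let y : ℕ → ℂ := fun l => if hl : l < m then ((ξ (⟨l, hl⟩, 1) : ℝ) : ℂ) else 0
  have hξ : (fun q : Fin m × Fin 2 => (ξ.ofLp q : ℂ)) =
      fun p => if p.2 = 0 then x p.1 else y p.1 := by
    funext ⟨i, e⟩
    fin_cases e <;> simp [x, y]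
  have hxy : ∀ l, l < m → ∀ σ : ℂ, (σ = Complex.I ∨ σ = -Complex.I) → ‖y l + σ * x l‖ ≤ ‖ξ‖ := by
    intro l hl σ hσ
    have hsq : ‖y l + σ * x l‖ ^ 2 = ξ (⟨l, hl⟩, 0) ^ 2 + ξ (⟨l, hl⟩, 1) ^ 2 := by
      rw [Complex.sq_norm, Complex.normSq_apply]
      rcases hσ with rfl | rfl <;> simp [x, y, hl] <;> ring
    refine le_of_sq_le_sq ?_ (norm_nonneg _)
    rw [hsq, EuclideanSpace.norm_sq_eq, Fintype.sum_prod_type]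
    simp only [Fin.sum_univ_two, Real.norm_eq_abs, sq_abs]
    exact Finset.single_le_sum (f := fun i : Fin m => ξ (i, 0) ^ 2 + ξ (i, 1) ^ 2)
      (fun i _ => by positivity) (Finset.mem_univ _)
  rw [hξ, leftVec_dotProduct, norm_mul]
  have : ‖(1 / 2 : ℂ)‖ = 1 / 2 := by norm_num
  rw [this]
  refine mul_le_mul_of_nonneg_left ?_ (by norm_num)
  rw [Finset.mul_sum]
  refine (norm_sum_le _ _).trans (Finset.sum_le_sum fun l hl => ?_)
  have hl := Finset.mem_range.1 hl
  refine (norm_add_le _ _).trans ?_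
  rw [norm_mul, norm_mul, mul_add, mul_comm ‖ξ‖, mul_comm ‖ξ‖]
  refine add_le_add (mul_le_mul_of_nonneg_left (hxy l hl _ (Or.inl rfl)) (norm_nonneg _))
    (mul_le_mul_of_nonneg_left ?_ (norm_nonneg _))
  have := hxy l hl _ (Or.inr rfl)
  rwa [neg_mul, ← sub_eq_add_neg] at this

theorem tendsto_hornerSum_zero {α : Type*} {F : Filter α} {U : α → ℂ} {h : α → ℕ → ℂ} {U₀ : ℂ}
    (hU : Tendsto U F (𝓝 U₀)) (hh : ∀ j, Tendsto (fun x => h x j) F (𝓝 0)) (l : ℕ) :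
    Tendsto (fun x => hornerSum (U x) (h x) l) F (𝓝 0) := by
  induction l with
  | zero => exact tendsto_const_nhds
  | succ l ih => simpa [hornerSum] using hU.mul (ih.add (hh l))

/-- The recursion run backwards: `W_l = w W_{l+1} - h_l` with `w = u⁻¹ → 0`. So the left eigenvector
concentrates in its last block, although `u` is unbounded. -/
theorem tendsto_hornerSum_of_lt {α : Type*} {F : Filter α} {u w : α → ℂ} {h : α → ℕ → ℂ} {L : ℂ}
    {m : ℕ} (huw : ∀ᶠ x in F, w x * u x = 1) (hw : Tendsto w F (𝓝 0))
    (hh : ∀ j, Tendsto (fun x => h x j) F (𝓝 0))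
    (hm : Tendsto (fun x => hornerSum (u x) (h x) m) F (𝓝 L)) (l : ℕ) (hl : l < m) :
    Tendsto (fun x => hornerSum (u x) (h x) l) F (𝓝 0) := by
  have step : ∀ l L', Tendsto (fun x => hornerSum (u x) (h x) (l + 1)) F (𝓝 L') →
      Tendsto (fun x => hornerSum (u x) (h x) l) F (𝓝 0) := by
    intro l L' hL'
    have h1 : Tendsto (fun x => w x * hornerSum (u x) (h x) (l + 1) - h x l) F (𝓝 0) := by
      simpa using (hw.mul hL').sub (hh l)
    refine h1.congr' ?_
    filter_upwards [huw] with x hx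
    rw [hornerSum, ← mul_assoc, hx]
    ring
  have key : ∀ i, ∃ L', Tendsto (fun x => hornerSum (u x) (h x) (m - i)) F (𝓝 L') := by
    intro i
    induction i with
    | zero => exact ⟨L, hm⟩
    | succ i ih =>
      obtain ⟨L', hL'⟩ := ih
      by_cases hi : i < m
      · have : m - i = m - (i + 1) + 1 := by omega
        rw [this] at hL'
        exact ⟨0, step _ _ hL'⟩
      · have : m - (i + 1) = m - i := by omega
        rw [this]
        exact ⟨L', hL'⟩
  obtain ⟨L', hL'⟩ := key (m - (l + 1))
  have : m - (m - (l + 1)) = l + 1 := by omega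
  rw [this] at hL'
  exact step _ _ hL'

/-! ### One eigenvalue branch and the limit of its weight. -/

/-- Here `ε = δ ^ r` and `u = η/δ` with `η → y₀`; the characteristic equation is multiplied by `δ ^
t`, and `he` records the power of `δ` then left in each term. In the weight, `l` contributes `2/λ`
(its last Horner sum), `v` contributes `‖y₀‖ ^ a / δ ^ a`, and `2 δ ^ (t + 1) (l·v)` tends to `S`.
-/
theorem exists_branch_bound {m : ℕ} (hm : 0 < m) {θ : ℝ} (hθ : Real.sin θ ≠ 0) {lam : ℝ}
    (hlam : 0 < lam) (c : ℕ → ℝ) (r t : ℕ) (hr : r ≠ 0) (e : ℕ → ℕ)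
    (he : ∀ j < m, t + r * gainExp m j = e j + (m - j)) (y₀ : ℂ) (hy₀ : y₀ ≠ 0)
    (hroot : ∑ j ∈ Finset.range m, cplxGain c j * 0 ^ e j * y₀ ^ (m - j) +
      0 ^ t * (2 / (lam : ℂ)) = 0)
    {S : ℂ} (hS : ∑ j ∈ Finset.range m,
      ((m - j : ℕ) : ℂ) * (cplxGain c j * 0 ^ e j * y₀ ^ (m - j + 1)) = S) (hS0 : S ≠ 0) :
    ∃ (z : ℝ → ℂ) (v l : ℝ → Fin m × Fin 2 → ℂ) (C : ℕ → ℝ → ℝ),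
      Tendsto (fun δ : ℝ => (z δ - Complex.exp (θ * Complex.I)) / δ) (𝓝[>] 0) (𝓝 y₀⁻¹) ∧
      (∀ a ≠ 0, Tendsto (C a) (𝓝[>] 0) (𝓝 (2 / lam * ‖y₀‖ ^ a / ‖S‖))) ∧
      ∀ᶠ δ in 𝓝[>] (0 : ℝ),
        (closedLoop m θ lam c (δ ^ r)).map (fun x : ℝ => (x : ℂ)) *ᵥ v δ = z δ • v δ ∧
        l δ ᵥ* (closedLoop m θ lam c (δ ^ r)).map (fun x : ℝ => (x : ℂ)) = z δ • l δ ∧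
        l δ ⬝ᵥ v δ ≠ 0 ∧
        ∀ (ξ : EuclideanSpace ℝ (Fin m × Fin 2)) (j : Fin m) (f : Fin 2),
          2 * ‖l δ ⬝ᵥ (fun q => (ξ.ofLp q : ℂ))‖ * ‖v δ (j, f)‖ / ‖l δ ⬝ᵥ v δ‖ ≤
            ‖ξ‖ * (C (m - j) δ * (δ ^ (t + 1) / δ ^ (m - j : ℕ))) := by
  set d : ℂ := Complex.exp (θ * Complex.I) - Complex.exp (-θ * Complex.I) with hd
  have hd0 : d ≠ 0 := by
    rw [hd, exp_mul_I_eq, exp_neg_mul_I_eq]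
    have h1 : (Complex.sin θ : ℂ) ≠ 0 := by exact_mod_cast hθ
    have h2 : Complex.cos θ + Complex.sin θ * Complex.I -
        (Complex.cos θ - Complex.sin θ * Complex.I) = 2 * Complex.sin θ * Complex.I := by ring
    rw [h2]
    simp [h1]
  obtain ⟨y, hy, hyroot⟩ := exists_perturbed_root m (cplxGain c)
    (fun j => starRingEnd ℂ (cplxGain c j)) e (fun j => r * gainExp m j) (fun j => m - j) t
    (2 / (lam : ℂ)) d y₀ hd0 hy₀ (fun j => mul_ne_zero hr (gainExp_ne_zero m j)) hroot
    (by rw [hS]; exact hS0)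
  have hcast : Tendsto (fun δ : ℝ => (δ : ℂ)) (𝓝[>] 0) (𝓝 0) := by
    have : Tendsto (fun δ : ℝ => (δ : ℂ)) (𝓝 0) (𝓝 ((0 : ℝ) : ℂ)) :=
      Complex.continuous_ofReal.tendsto 0
    simpa using this.mono_left nhdsWithin_le_nhds
  let η : ℝ → ℂ := fun δ => y δ
  have hη : Tendsto η (𝓝[>] 0) (𝓝 y₀) := hy.comp hcast
  let u : ℝ → ℂ := fun δ => η δ / δ
  let w : ℝ → ℂ := fun δ => δ / η δ
  let U : ℝ → ℂ := fun δ => η δ * (d * η δ + δ)⁻¹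
  let h : ℝ → ℕ → ℂ := fun δ j => gainWeight m (δ ^ r) j * cplxGain c j
  let h' : ℝ → ℕ → ℂ := fun δ j => gainWeight m (δ ^ r) j * starRingEnd ℂ (cplxGain c j)
  let S' : ℝ → ℂ := fun δ => ∑ j ∈ Finset.range m, ((m - j : ℕ) : ℂ) *
    (cplxGain c j * δ ^ e j * η δ ^ (m - j + 1) + δ ^ (t + 1) * (h' δ j * U δ ^ (m - j + 1)))
  let B : ℝ → ℝ := fun δ => ∑ i ∈ Finset.range m,
    (‖hornerSum (u δ) (h δ) (i + 1)‖ + ‖hornerSum (U δ) (h' δ) (i + 1)‖)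
  have hw : Tendsto w (𝓝[>] 0) (𝓝 0) := by
    have := hcast.div hη hy₀
    rwa [zero_div] at this
  have hden : Tendsto (fun δ : ℝ => d * η δ + δ) (𝓝[>] 0) (𝓝 (d * y₀)) := by
    simpa using (hη.const_mul d).add hcast
  have hU : Tendsto U (𝓝[>] 0) (𝓝 (y₀ * (d * y₀)⁻¹)) :=
    hη.mul (hden.inv₀ (mul_ne_zero hd0 hy₀))
  have hweight : ∀ j, Tendsto (fun δ : ℝ => (gainWeight m (δ ^ r) j : ℂ)) (𝓝[>] 0) (𝓝 0) := by
    intro j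
    simp only [gainWeight_eq, ← pow_mul]
    have := hcast.pow (r * gainExp m j)
    rw [zero_pow (mul_ne_zero hr (gainExp_ne_zero m j))] at this
    exact this.congr fun δ => by push_cast; rfl
  have hh : ∀ j, Tendsto (fun δ => h δ j) (𝓝[>] 0) (𝓝 0) := fun j => by
    simpa using (hweight j).mul_const (cplxGain c j)
  have hh' : ∀ j, Tendsto (fun δ => h' δ j) (𝓝[>] 0) (𝓝 0) := fun j => by
    simpa using (hweight j).mul_const (starRingEnd ℂ (cplxGain c j))
  have hD := tendsto_hornerSum_zero hU hh'
  have hpos : ∀ᶠ δ in 𝓝[>] (0 : ℝ), 0 < δ := eventually_mem_nhdsWithin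
  have hηne : ∀ᶠ δ in 𝓝[>] (0 : ℝ), η δ ≠ 0 := hη.eventually_ne hy₀
  have hdenne : ∀ᶠ δ in 𝓝[>] (0 : ℝ), d * η δ + δ ≠ 0 :=
    hden.eventually_ne (mul_ne_zero hd0 hy₀)
  have hroot' := hcast.eventually hyroot
  have hgw : ∀ (δ : ℝ) j, (gainWeight m (δ ^ r) j : ℂ) = (δ : ℂ) ^ (r * gainExp m j) := by
    intro δ j
    rw [gainWeight_eq, ← pow_mul]
    push_cast
    rfl
  -- The exponent identity `he` cancels all negative powers of `δ`, so the equation extends to `δ =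
  -- 0`.
  have hkey : ∀ (δ : ℝ), 0 < δ → ∀ j < m, (δ : ℂ) ^ t * gainWeight m (δ ^ r) j * u δ ^ (m - j) =
      (δ : ℂ) ^ e j * η δ ^ (m - j) := by
    intro δ hδ j hj
    have hδ' : (δ : ℂ) ≠ 0 := by exact_mod_cast hδ.ne'
    rw [hgw, ← pow_add, he j hj, pow_add, mul_assoc, ← mul_pow]
    simp only [u]
    rw [mul_div_cancel₀ _ hδ']
  have heq : ∀ᶠ δ in 𝓝[>] (0 : ℝ), 2 / (lam : ℂ) + ∑ j ∈ Finset.range m,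
      (gainWeight m (δ ^ r) j : ℂ) * (cplxGain c j * u δ ^ (m - j) +
      starRingEnd ℂ (cplxGain c j) * U δ ^ (m - j)) = 0 := by
    filter_upwards [hpos, hroot'] with δ hδ hrt
    have hδ' : (δ : ℂ) ≠ 0 := by exact_mod_cast hδ.ne'
    have : (δ : ℂ) ^ t * (2 / (lam : ℂ) + ∑ j ∈ Finset.range m,
        (gainWeight m (δ ^ r) j : ℂ) * (cplxGain c j * u δ ^ (m - j) +
        starRingEnd ℂ (cplxGain c j) * U δ ^ (m - j))) = 0 := by
      rw [← hrt, mul_add _ (2 / (lam : ℂ)), mul_add _ (2 / (lam : ℂ)), add_left_comm,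
        Finset.mul_sum, Finset.mul_sum, ← Finset.sum_add_distrib]
      congr 1
      refine Finset.sum_congr rfl fun j hj => ?_
      have h1 := hkey δ hδ j (Finset.mem_range.1 hj)
      have h2 := hgw δ j
      simp only [η, U] at h1 ⊢
      rw [← h2]
      linear_combination cplxGain c j * h1
    exact (mul_eq_zero.1 this).resolve_left (pow_ne_zero _ hδ')
  have heq' : ∀ᶠ δ in 𝓝[>] (0 : ℝ), 2 / (lam : ℂ) +
      (hornerSum (u δ) (h δ) m + hornerSum (U δ) (h' δ) m) = 0 := by
    filter_upwards [heq] with δ hδ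
    rw [← hδ, hornerSum_eq, hornerSum_eq, ← Finset.sum_add_distrib]
    congr 1
    exact Finset.sum_congr rfl fun j _ => by simp only [h, h']; ring
  have hWm : Tendsto (fun δ => hornerSum (u δ) (h δ) m) (𝓝[>] 0) (𝓝 (-(2 / (lam : ℂ)))) := by
    have h1 := ((hD m).const_add (2 / (lam : ℂ))).neg
    rw [add_zero] at h1
    refine h1.congr' ?_
    filter_upwards [heq'] with δ hδ
    linear_combination -hδ
  have hwu : ∀ᶠ δ in 𝓝[>] (0 : ℝ), w δ * u δ = 1 := by
    filter_upwards [hpos, hηne] with δ hδ h1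
    have hδ' : (δ : ℂ) ≠ 0 := by exact_mod_cast hδ.ne'
    simp only [w, u]
    field_simp
  have hW := tendsto_hornerSum_of_lt hwu hw hh hWm
  have hB : Tendsto B (𝓝[>] 0) (𝓝 (2 / lam)) := by
    obtain ⟨m', rfl⟩ := Nat.exists_eq_add_of_le' hm
    simp only [B, Finset.sum_range_succ]
    have h1 : Tendsto (fun δ => ∑ i ∈ Finset.range m',
        (‖hornerSum (u δ) (h δ) (i + 1)‖ + ‖hornerSum (U δ) (h' δ) (i + 1)‖)) (𝓝[>] 0)
        (𝓝 (∑ i ∈ Finset.range m', (‖(0 : ℂ)‖ + ‖(0 : ℂ)‖))) :=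
      tendsto_finsetSum _ fun i hi =>
        (hW (i + 1) (by have := Finset.mem_range.1 hi; omega)).norm.add (hD (i + 1)).norm
    have h2 := h1.add (hWm.norm.add (hD (m' + 1)).norm)
    simpa [abs_of_pos hlam] using h2
  have hS' : Tendsto S' (𝓝[>] 0) (𝓝 S) := by
    rw [← hS]
    refine tendsto_finsetSum _ fun j _ => Tendsto.const_mul _ ?_
    have h1 := ((hcast.pow (e j)).const_mul (cplxGain c j)).mul (hη.pow (m - j + 1))
    have h2 := (hcast.pow (t + 1)).mul ((hh' j).mul (hU.pow (m - j + 1)))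
    simpa using h1.add h2
  have hlv : ∀ᶠ δ : ℝ in 𝓝[>] (0 : ℝ), (δ : ℂ) ^ (t + 1) *
      (2 * ((fun p : Fin m × Fin 2 => leftVec (u δ) (U δ) (h δ) (h' δ) p.1 p.2) ⬝ᵥ
        (fun p => rightVec m (u δ) (U δ) p.1 p.2))) = S' δ := by
    filter_upwards [hpos] with δ hδ
    have hδ' : (δ : ℂ) ≠ 0 := by exact_mod_cast hδ.ne'
    rw [leftVec_dotProduct_rightVec, ← mul_assoc 2, mul_one_div_cancel two_ne_zero, one_mul,
      Finset.mul_sum]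
    refine Finset.sum_congr rfl fun j hj => ?_
    have h1 := hkey δ hδ j (Finset.mem_range.1 hj)
    have h2 : (δ : ℂ) * u δ = η δ := by simp only [u]; rw [mul_div_cancel₀ _ hδ']
    have h3 : (δ : ℂ) ^ (t + 1) * (h δ j * u δ ^ (m - j + 1)) =
        cplxGain c j * δ ^ e j * η δ ^ (m - j + 1) := by
      simp only [h]
      rw [pow_succ (η δ), ← h2]
      rw [← h2] at h1
      linear_combination cplxGain c j * (δ : ℂ) * u δ * h1
    rw [← h3]
    ring
  refine ⟨fun δ => Complex.exp (θ * Complex.I) + w δ,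
    fun δ p => rightVec m (u δ) (U δ) p.1 p.2,
    fun δ p => leftVec (u δ) (U δ) (h δ) (h' δ) p.1 p.2,
    fun a δ => B δ * (‖η δ‖ ^ a + δ ^ a * ‖U δ‖ ^ a) / ‖S' δ‖, ?_, ?_, ?_⟩
  · refine (hη.inv₀ hy₀).congr' ?_
    filter_upwards [hpos] with δ hδ
    have hδ' : (δ : ℂ) ≠ 0 := by exact_mod_cast hδ.ne'
    simp only [w]
    field_simp
    ring
  · intro a ha
    have hid : Tendsto (fun δ : ℝ => δ) (𝓝[>] 0) (𝓝 0) := tendsto_id.mono_left nhdsWithin_le_nhds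
    have h1 := (hid.pow a).mul (hU.norm.pow a)
    rw [zero_pow ha, zero_mul] at h1
    have h2 := (hB.mul ((hη.norm.pow a).add h1)).div hS'.norm (norm_ne_zero_iff.2 hS0)
    rwa [add_zero] at h2
  · filter_upwards [hpos, hwu, hηne, hdenne, heq, heq', hlv, hS'.eventually_ne hS0] with
      δ hδ hwuδ hηδ hdenδ heqδ heqδ' hlvδ hSδ
    have hδ' : (δ : ℂ) ≠ 0 := by exact_mod_cast hδ.ne'
    have hu1 : u δ * (Complex.exp (θ * Complex.I) + w δ - Complex.exp (θ * Complex.I)) = 1 := by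
      rw [add_sub_cancel_left, mul_comm]; exact hwuδ
    have hU1 : U δ * (Complex.exp (θ * Complex.I) + w δ - Complex.exp (-θ * Complex.I)) = 1 := by
      have : Complex.exp (θ * Complex.I) + w δ - Complex.exp (-θ * Complex.I) = d + w δ := by
        rw [hd]; ring
      rw [this]
      simp only [U, w]
      field_simp
      rw [mul_comm (η δ)]
      exact div_self hdenδ
    refine ⟨closedLoop_mulVec_rightVec hlam.ne' hu1 hU1 heqδ,
      leftVec_vecMul_closedLoop hlam.ne' hu1 hU1 (fun _ => rfl) (fun _ => rfl) heqδ', ?_, ?_⟩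
    · intro h0
      rw [h0, mul_zero, mul_zero] at hlvδ
      exact hSδ hlvδ.symm
    · intro ξ j f
      have hlnorm := norm_leftVec_dotProduct_le m (u δ) (U δ) (h δ) (h' δ) ξ
      have hvnorm := norm_rightVec_le m (u δ) (U δ) j f
      set lξ := (fun p : Fin m × Fin 2 => leftVec (u δ) (U δ) (h δ) (h' δ) p.1 p.2) ⬝ᵥ
        (fun q => (ξ.ofLp q : ℂ))
      set lv := (fun p : Fin m × Fin 2 => leftVec (u δ) (U δ) (h δ) (h' δ) p.1 p.2) ⬝ᵥ
        (fun p => rightVec m (u δ) (U δ) p.1 p.2) with hlvdef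
      have hnS : δ ^ (t + 1) * (2 * ‖lv‖) = ‖S' δ‖ := by
        rw [← hlvδ, norm_mul, norm_mul, norm_pow, Complex.norm_real, Real.norm_eq_abs,
          abs_of_pos hδ]
        simp
      have hlv0 : 0 < ‖lv‖ := by
        have h1 : 0 < ‖S' δ‖ := norm_pos_iff.2 hSδ
        rw [← hnS] at h1
        have := pos_of_mul_pos_right h1 (by positivity)
        linarith
      have hun : ‖u δ‖ = ‖η δ‖ / δ := by
        simp only [u]
        rw [norm_div, Complex.norm_real, Real.norm_eq_abs, abs_of_pos hδ]
      rw [div_le_iff₀ hlv0, ← hnS]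
      calc 2 * ‖lξ‖ * ‖rightVec m (u δ) (U δ) j f‖
          ≤ 2 * (1 / 2 * (‖ξ‖ * B δ)) * (1 / 2 * (‖u δ‖ ^ (m - (j : ℕ)) + ‖U δ‖ ^ (m - (j : ℕ)))) := by
            gcongr
        _ = _ := by
            rw [hun, div_pow]
            field_simp

/-! ### The polynomial with roots `ϑ_n`. -/

open Filter Topology Polynomial

/-- The polynomial `∑_{j < m-1} (c_{2j+2} - c_{2j+1} i) X^j` whose roots are the numbers `ϑ_n`. -/
def gainPoly (m : ℕ) (c : ℕ → ℝ) : ℂ[X] :=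
  ∑ j ∈ Finset.range (m - 1), C (cplxGain c j) * X ^ j

/-- The prescribed values of `c_{2m-3}` and `c_{2m-2}` make this gain equal to `e^{2iθ}`. -/
theorem norm_cplxGain {m : ℕ} (hm : 2 ≤ m) {θ lam : ℝ} {c : ℕ → ℝ} {ϑ : ℕ → ℂ}
    (hc : GainChoice m θ lam c ϑ) : ‖cplxGain c (m - 2)‖ = 1 := by
  have h1 : 2 * (m - 2) + 2 = 2 * m - 2 := by omega
  have h2 : 2 * (m - 2) + 1 = 2 * m - 3 := by omega
  rw [cplxGain, h1, h2, hc.c_even, hc.c_odd]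
  have : ((Real.cos (2 * θ) : ℝ) : ℂ) - ((-Real.sin (2 * θ) : ℝ) : ℂ) * Complex.I =
      Complex.exp (((2 * θ : ℝ) : ℂ) * Complex.I) := by
    rw [Complex.exp_mul_I]; push_cast; ring
  rw [this, Complex.norm_exp_ofReal_mul_I]

theorem eval_gainPoly (m : ℕ) (c : ℕ → ℝ) (x : ℂ) :
    (gainPoly m c).eval x = ∑ j ∈ Finset.range (m - 1), cplxGain c j * x ^ j := by
  simp [gainPoly, eval_finsetSum]

theorem eval_gainPoly_root {m : ℕ} (hm : 3 ≤ m) {θ lam : ℝ} {c : ℕ → ℝ} {ϑ : ℕ → ℂ}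
    (hc : GainChoice m θ lam c ϑ) {n : ℕ} (hn : n ∈ Finset.Icc 3 m) :
    (gainPoly m c).eval (ϑ n) = 0 := by
  rw [eval_gainPoly, ← hc.root hm n hn]
  refine Finset.sum_nbij' (fun j => j + 1) (fun j => j - 1) ?_ ?_ ?_ ?_ ?_
  · intro j hj
    simp only [Finset.mem_range, Finset.mem_Icc] at *
    omega
  · intro j hj
    simp only [Finset.mem_range, Finset.mem_Icc] at *
    omega
  · intro j _; simp
  · intro j hj
    simp only [Finset.mem_Icc] at *
    omega
  · intro j _
    rw [cplxGain]
    congr 4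

theorem gainPoly_eq {m : ℕ} (hm : 3 ≤ m) {θ lam : ℝ} {c : ℕ → ℝ} {ϑ : ℕ → ℂ}
    (hc : GainChoice m θ lam c ϑ) :
    gainPoly m c = C (cplxGain c (m - 2)) * Lagrange.nodal (Finset.Icc 3 m) ϑ := by
  have hinj : Set.InjOn ϑ (Finset.Icc 3 m : Finset ℕ) := by
    simpa using hc.distinct hm
  have hcard : (Finset.Icc 3 m).card = m - 2 := by simp
  have hdeg : (Lagrange.nodal (Finset.Icc 3 m) ϑ).degree = ((m - 2 : ℕ) : WithBot ℕ) := by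
    rw [Lagrange.degree_nodal, hcard]
  have hmon : (Lagrange.nodal (Finset.Icc 3 m) ϑ).Monic := Lagrange.nodal_monic
  have hr : m - 1 = m - 2 + 1 := by omega
  have hlow : (∑ j ∈ Finset.range (m - 2), C (cplxGain c j) * X ^ j).degree < ((m - 2 : ℕ) : WithBot ℕ) := by
    refine (degree_sum_le _ _).trans_lt ?_
    rw [Finset.sup_lt_iff (WithBot.bot_lt_coe _)]
    intro j hj
    refine (degree_C_mul_X_pow_le _ _).trans_lt ?_
    exact_mod_cast Finset.mem_range.1 hj
  refine eq_of_degree_sub_lt_of_eval_finset_eq (s := (Finset.Icc 3 m).image ϑ) ?_ ?_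
  · rw [Finset.card_image_of_injOn hinj, hcard, gainPoly, hr, Finset.sum_range_succ, add_sub_assoc,
      ← mul_sub]
    refine (degree_add_le _ _).trans_lt (max_lt hlow ?_)
    have hg0 : cplxGain c (m - 2) ≠ 0 :=
      norm_ne_zero_iff.1 (by rw [norm_cplxGain (by omega) hc]; exact one_ne_zero)
    rw [degree_C_mul hg0]
    have : (X ^ (m - 2) - Lagrange.nodal (Finset.Icc 3 m) ϑ).degree < (X ^ (m - 2) : ℂ[X]).degree :=
      degree_sub_lt_left (by rw [hdeg, degree_X_pow]) (by simp)
        (by rw [hmon.leadingCoeff, leadingCoeff_X_pow])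
    rwa [degree_X_pow] at this
  · intro x hx
    obtain ⟨n, hn, rfl⟩ := Finset.mem_image.1 hx
    rw [eval_gainPoly_root hm hc hn, eval_mul, Lagrange.eval_nodal_at_node hn, mul_zero]

/-- Source of the products in `vandermondeSum`: the leading coefficient has modulus 1, and the
derivative of a nodal polynomial at a node is the product of the differences. -/
theorem norm_eval_derivative_gainPoly {m : ℕ} (hm : 3 ≤ m) {θ lam : ℝ} {c : ℕ → ℝ} {ϑ : ℕ → ℂ}
    (hc : GainChoice m θ lam c ϑ) {n : ℕ} (hn : n ∈ Finset.Icc 3 m) :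
    ‖(derivative (gainPoly m c)).eval (ϑ n)‖ =
      ∏ k ∈ (Finset.Icc 3 m).erase n, ‖ϑ k - ϑ n‖ := by
  rw [gainPoly_eq hm hc, derivative_C_mul, eval_C_mul, norm_mul, norm_cplxGain (by omega) hc,
    one_mul, Lagrange.eval_nodal_derivative_eval_node_eq hn, Lagrange.eval_nodal, norm_prod]
  exact Finset.prod_congr rfl fun k _ => norm_sub_rev _ _

theorem prod_norm_sub_pos {m : ℕ} (hm : 3 ≤ m) {θ lam : ℝ} {c : ℕ → ℝ} {ϑ : ℕ → ℂ}
    (hc : GainChoice m θ lam c ϑ) {n : ℕ} (hn : n ∈ Finset.Icc 3 m) :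
    0 < ∏ k ∈ (Finset.Icc 3 m).erase n, ‖ϑ k - ϑ n‖ := by
  refine Finset.prod_pos fun k hk => norm_pos_iff.2 (sub_ne_zero.2 fun h => ?_)
  obtain ⟨hkn, hk⟩ := Finset.mem_erase.1 hk
  exact hkn (hc.distinct hm (Finset.mem_Icc.1 hk) (Finset.mem_Icc.1 hn) h)

theorem root_ne_zero {m : ℕ} (hm : 3 ≤ m) {θ lam : ℝ} {c : ℕ → ℝ} {ϑ : ℕ → ℂ}
    (hc : GainChoice m θ lam c ϑ) {n : ℕ} (hn : n ∈ Finset.Icc 3 m) : ϑ n ≠ 0 := by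
  intro h
  have := hc.root_neg hm n hn
  simp [h] at this

/-! ### The two families of eigenvalues near `e^{iθ}`. -/

theorem exists_slow_branch {m : ℕ} (hm : 3 ≤ m) {θ : ℝ} (hθ : Real.sin θ ≠ 0) {lam : ℝ}
    (hlam : 0 < lam) {c : ℕ → ℝ} {ϑ : ℕ → ℂ} (hc : GainChoice m θ lam c ϑ) {n : ℕ}
    (hn : n ∈ Finset.Icc 3 m) :
    ∃ (z : ℝ → ℂ) (v l : ℝ → Fin m × Fin 2 → ℂ) (C : ℕ → ℝ → ℝ),
      Tendsto (fun δ : ℝ => (z δ - Complex.exp (θ * Complex.I)) / δ) (𝓝[>] 0) (𝓝 (ϑ n)) ∧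
      (∀ j < m, Tendsto (C (m - j)) (𝓝[>] 0) (𝓝 (2 / lam *
        (‖ϑ n‖ ^ j / ∏ k ∈ (Finset.Icc 3 m).erase n, ‖ϑ k - ϑ n‖)))) ∧
      ∀ᶠ δ in 𝓝[>] (0 : ℝ),
        (closedLoop m θ lam c (δ ^ 1)).map (fun x : ℝ => (x : ℂ)) *ᵥ v δ = z δ • v δ ∧
        l δ ᵥ* (closedLoop m θ lam c (δ ^ 1)).map (fun x : ℝ => (x : ℂ)) = z δ • l δ ∧
        l δ ⬝ᵥ v δ ≠ 0 ∧
        ∀ (ξ : EuclideanSpace ℝ (Fin m × Fin 2)) (j : Fin m) (f : Fin 2),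
          2 * ‖l δ ⬝ᵥ (fun q => (ξ.ofLp q : ℂ))‖ * ‖v δ (j, f)‖ / ‖l δ ⬝ᵥ v δ‖ ≤
            ‖ξ‖ * (C (m - j) δ * (δ ^ (1 + 1) / δ ^ (m - j : ℕ))) := by
  have h0 := root_ne_zero hm hc hn
  have hD := norm_eval_derivative_gainPoly hm hc hn
  have hP := prod_norm_sub_pos hm hc hn
  have hf := eval_gainPoly_root hm hc hn
  set D := (derivative (gainPoly m c)).eval (ϑ n) with hDdef
  have hD0 : D ≠ 0 := norm_pos_iff.1 (hD ▸ hP)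
  have hr : m = m - 1 + 1 := by omega
  have hsum : ∀ F : ℕ → ℂ, (∑ j ∈ Finset.range m,
      F j * 0 ^ (if j + 1 < m then 0 else 1)) = ∑ j ∈ Finset.range (m - 1), F j := by
    intro F
    rw [hr, Finset.sum_range_succ, ← hr, if_neg (by omega), pow_one, mul_zero, add_zero]
    refine Finset.sum_congr rfl fun j hj => ?_
    rw [if_pos (by have := Finset.mem_range.1 hj; omega), pow_zero, mul_one]
  have hinv : ∀ j < m, (ϑ n)⁻¹ ^ (m - j) = (ϑ n)⁻¹ ^ m * ϑ n ^ j := by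
    intro j hj
    conv_rhs => rw [← Nat.sub_add_cancel hj.le, pow_add, mul_assoc, ← mul_pow, inv_mul_cancel₀ h0,
      one_pow, mul_one]
  -- With `r = t = 1` all gains but the last pair survive at `δ = 0`, while `2/λ` drops out. The
  -- limit equation is `y ^ m p(1/y) = 0` with `p = gainPoly m c`.
  obtain ⟨z, v, l, C, hz, hC, hev⟩ := exists_branch_bound (m := m) (by omega) hθ hlam c 1 1 one_ne_zero
    (fun j => if j + 1 < m then 0 else 1)
    (by intro j hj; unfold gainExp; split_ifs <;> omega) (ϑ n)⁻¹ (inv_ne_zero h0)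
    (by
      have : ∀ j, cplxGain c j * 0 ^ (if j + 1 < m then 0 else 1) * (ϑ n)⁻¹ ^ (m - j) =
        cplxGain c j * (ϑ n)⁻¹ ^ (m - j) * 0 ^ (if j + 1 < m then 0 else 1) := fun j => by ring
      simp only [this]
      rw [hsum, pow_one, zero_mul, add_zero]
      have h1 : ∑ j ∈ Finset.range (m - 1), cplxGain c j * (ϑ n)⁻¹ ^ (m - j) =
          (ϑ n)⁻¹ ^ m * (gainPoly m c).eval (ϑ n) := by
        rw [eval_gainPoly, Finset.mul_sum]
        refine Finset.sum_congr rfl fun j hj => ?_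
        rw [hinv j (by have := Finset.mem_range.1 hj; omega)]
        ring
      rw [h1, hf, mul_zero])
    -- This is `y²` times the derivative of `y ^ m p(1/y)` at `y = 1/ϑ_n`, where `p(ϑ_n) = 0`.
    (S := -((ϑ n)⁻¹ ^ m * D))
    (by
      have : ∀ j, ((m - j : ℕ) : ℂ) * (cplxGain c j * 0 ^ (if j + 1 < m then 0 else 1) *
        (ϑ n)⁻¹ ^ (m - j + 1)) = ((m - j : ℕ) : ℂ) * (cplxGain c j * (ϑ n)⁻¹ ^ (m - j + 1)) *
        0 ^ (if j + 1 < m then 0 else 1) := fun j => by ring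
      simp only [this]
      rw [hsum]
      have h1 : ∑ j ∈ Finset.range (m - 1), ((m - j : ℕ) : ℂ) *
          (cplxGain c j * (ϑ n)⁻¹ ^ (m - j + 1)) =
          (ϑ n)⁻¹ ^ (m + 1) * (m * (gainPoly m c).eval (ϑ n) - ϑ n * D) := by
        rw [hDdef, eval_gainPoly, gainPoly, derivative_sum, eval_finsetSum, Finset.mul_sum,
          Finset.mul_sum, ← Finset.sum_sub_distrib, Finset.mul_sum]
        refine Finset.sum_congr rfl fun j hj => ?_
        have hjm : j < m := by have := Finset.mem_range.1 hj; omega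
        rw [pow_succ, hinv j hjm, Nat.cast_sub hjm.le]
        simp only [derivative_C_mul, derivative_X_pow, eval_mul, eval_C, eval_pow, eval_X]
        rcases Nat.eq_zero_or_pos j with rfl | hj0
        · simp; ring
        · obtain ⟨b, rfl⟩ := Nat.exists_eq_add_of_le' hj0
          simp only [Nat.add_sub_cancel]
          ring
      rw [h1, hf, pow_succ]
      field_simp
      ring)
    (neg_ne_zero.2 (mul_ne_zero (pow_ne_zero _ (inv_ne_zero h0)) hD0))
  refine ⟨z, v, l, C, by simpa using hz, fun j hj => ?_, hev⟩
  have := hC (m - j) (by omega)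
  convert this using 2
  have h2 : ‖(ϑ n)⁻¹‖ ^ (m - j) = ‖(ϑ n)⁻¹‖ ^ m * ‖ϑ n‖ ^ j := by
    rw [← norm_pow, hinv j hj, norm_mul, norm_pow, norm_pow]
  rw [norm_neg, norm_mul, norm_pow, hD, h2, mul_div_assoc]
  congr 1
  have h1 : ‖(ϑ n)⁻¹‖ ^ m ≠ 0 := pow_ne_zero _ (norm_ne_zero_iff.2 (inv_ne_zero h0))
  rw [mul_div_mul_left _ _ h1]

theorem exists_fast_branch {m : ℕ} (hm : 2 ≤ m) {θ : ℝ} (hθ : Real.sin θ ≠ 0) {lam : ℝ}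
    (hlam : 0 < lam) {c : ℕ → ℝ} (hg : ‖cplxGain c (m - 2)‖ = 1) {y₀ : ℂ}
    (hy : cplxGain c (m - 2) * y₀ ^ 2 + 2 / (lam : ℂ) = 0) :
    ∃ (z : ℝ → ℂ) (v l : ℝ → Fin m × Fin 2 → ℂ) (C : ℕ → ℝ → ℝ),
      Tendsto (fun δ : ℝ => (z δ - Complex.exp (θ * Complex.I)) / δ) (𝓝[>] 0) (𝓝 y₀⁻¹) ∧
      (∀ a, Tendsto (C (a + 1)) (𝓝[>] 0) (𝓝 (√(2 / lam) ^ a / 2))) ∧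
      ∀ᶠ δ in 𝓝[>] (0 : ℝ),
        (closedLoop m θ lam c (δ ^ 2)).map (fun x : ℝ => (x : ℂ)) *ᵥ v δ = z δ • v δ ∧
        l δ ᵥ* (closedLoop m θ lam c (δ ^ 2)).map (fun x : ℝ => (x : ℂ)) = z δ • l δ ∧
        l δ ⬝ᵥ v δ ≠ 0 ∧
        ∀ (ξ : EuclideanSpace ℝ (Fin m × Fin 2)) (j : Fin m) (f : Fin 2),
          2 * ‖l δ ⬝ᵥ (fun q => (ξ.ofLp q : ℂ))‖ * ‖v δ (j, f)‖ / ‖l δ ⬝ᵥ v δ‖ ≤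
            ‖ξ‖ * (C (m - j) δ * (δ ^ (0 + 1) / δ ^ (m - j : ℕ))) := by
  have hl0 : (lam : ℂ) ≠ 0 := by exact_mod_cast hlam.ne'
  have hy0 : y₀ ≠ 0 := by
    rintro rfl
    simp [hl0] at hy
  have hg0 : cplxGain c (m - 2) ≠ 0 := norm_ne_zero_iff.1 (by rw [hg]; exact one_ne_zero)
  have hsum : ∀ F : ℕ → ℂ, (∑ j ∈ Finset.range m,
      F j * 0 ^ (if j + 1 < m then m - 2 - j else 1)) = F (m - 2) := by
    intro F
    rw [Finset.sum_eq_single (m - 2)]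
    · rw [if_pos (by omega), Nat.sub_self, pow_zero, mul_one]
    · intro j hj hne
      have := Finset.mem_range.1 hj
      rw [zero_pow (by split_ifs <;> omega), mul_zero]
    · intro h
      exact absurd (Finset.mem_range.2 (by omega)) h
  have h2 : m - (m - 2) = 2 := by omega
  -- With `r = 2`, `t = 0` only the gain of index `m - 2` balances `2/λ`; every other term carries a
  -- positive power of `δ`.
  obtain ⟨z, v, l, C, hz, hC, hev⟩ := exists_branch_bound (m := m) (by omega) hθ hlam c 2 0 two_ne_zero
    (fun j => if j + 1 < m then m - 2 - j else 1)
    (by intro j hj; unfold gainExp; split_ifs <;> omega) y₀ hy0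
    (by
      have : ∀ j, cplxGain c j * 0 ^ (if j + 1 < m then m - 2 - j else 1) * y₀ ^ (m - j) =
        cplxGain c j * y₀ ^ (m - j) * 0 ^ (if j + 1 < m then m - 2 - j else 1) :=
          fun j => by ring
      simp only [this]
      rw [hsum, pow_zero, one_mul, h2, hy])
    (S := 2 * (cplxGain c (m - 2) * y₀ ^ 3))
    (by
      have : ∀ j, ((m - j : ℕ) : ℂ) * (cplxGain c j * 0 ^ (if j + 1 < m then m - 2 - j else 1) *
        y₀ ^ (m - j + 1)) = ((m - j : ℕ) : ℂ) * (cplxGain c j * y₀ ^ (m - j + 1)) *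
        0 ^ (if j + 1 < m then m - 2 - j else 1) := fun j => by ring
      simp only [this]
      rw [hsum, h2]
      norm_num)
    (by simp [hg0, hy0])
  refine ⟨z, v, l, C, hz, fun a => ?_, hev⟩
  have hsq : ‖y₀‖ ^ 2 = 2 / lam := by
    have h3 : ‖cplxGain c (m - 2) * y₀ ^ 2‖ = ‖-(2 / (lam : ℂ))‖ := by
      rw [eq_neg_of_add_eq_zero_left hy]
    rw [norm_mul, hg, one_mul, norm_pow, norm_neg] at h3
    simpa [abs_of_pos hlam] using h3
  have hn : √(2 / lam) = ‖y₀‖ := by rw [← hsq, Real.sqrt_sq (norm_nonneg _)]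
  convert hC (a + 1) (by omega) using 2
  have hy0' : ‖y₀‖ ≠ 0 := norm_ne_zero_iff.2 hy0
  rw [hn, ← hsq, norm_mul, norm_mul, hg, norm_pow]
  simp only [RCLike.norm_ofNat]
  field_simp
  ring

/-! ### Comparison with `M_{ij}` and assembly. -/

theorem eventually_ne_of_tendsto {α : Type*} {F : Filter α} {f g : α → ℂ} {a b : ℂ}
    (hf : Tendsto f F (𝓝 a)) (hg : Tendsto g F (𝓝 b)) (hab : a ≠ b) : ∀ᶠ x in F, f x ≠ g x :=
  ((hf.sub hg).eventually_ne (sub_ne_zero.2 hab)).mono fun _ h => sub_ne_zero.1 h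

theorem vandermondeSum_pos {m : ℕ} (hm : 3 ≤ m) {θ lam : ℝ} {c : ℕ → ℝ} {ϑ : ℕ → ℂ}
    (hc : GainChoice m θ lam c ϑ) (j : ℕ) : 0 < vandermondeSum m ϑ j :=
  Finset.sum_pos (fun _ hn => div_pos (pow_pos (norm_pos_iff.2 (root_ne_zero hm hc hn)) _)
    (prod_norm_sub_pos hm hc hn)) ⟨3, Finset.mem_Icc.2 ⟨le_rfl, hm⟩⟩

/-- Comparison of the limiting constants with `M_j`: `P` and `R` stand for the contributions of the
eigenvalues at distance of order `δ ^ 2` and `δ` from `e^{iθ}`, where `ε = δ ^ 2`. -/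
theorem eventually_le_Mconst_mul_epsPower {m : ℕ} {θ lam : ℝ} (hlam : 0 < lam)
    {c : ℕ → ℝ} {ϑ : ℕ → ℂ} (hc : GainChoice m θ lam c ϑ) {j a : ℕ} (hj : j + (a + 1) = m)
    {P R : ℝ → ℝ} (hP : Tendsto P (𝓝[>] 0) (𝓝 (2 / lam * vandermondeSum m ϑ (j + 1))))
    (hR : Tendsto R (𝓝[>] 0) (𝓝 (√(2 / lam) ^ a))) :
    ∀ᶠ δ in 𝓝[>] (0 : ℝ), P δ * ((δ ^ 2) ^ 2 / (δ ^ 2) ^ (a + 1)) + R δ * (δ / δ ^ (a + 1)) ≤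
      Mconst m lam ϑ (j + 1) * epsPower m (δ ^ 2) (j + 1) := by
  have hpos : ∀ᶠ δ in 𝓝[>] (0 : ℝ), 0 < δ := eventually_mem_nhdsWithin
  have hid : Tendsto (fun δ : ℝ => δ) (𝓝[>] 0) (𝓝 0) := tendsto_id.mono_left nhdsWithin_le_nhds
  have hsq : √(2 / lam) ^ 2 = 2 / lam := Real.sq_sqrt (by positivity)
  -- The two contributions have orders `ε ^ (1 - a)` and `ε ^ (-a/2)`. The first dominates for `a >
  -- 2`, the second for `a < 2`; they tie at `a = 2`, which explains the extra `+ 1` in `M_{i,m-2}`.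
  by_cases ha : 2 ≤ a
  · obtain ⟨b, rfl⟩ := Nat.exists_eq_add_of_le' ha
    have hv := vandermondeSum_pos (by omega) hc (j + 1)
    have hlim := hP.add (hR.mul (hid.pow b))
    have hlt : 2 / lam * vandermondeSum m ϑ (j + 1) + √(2 / lam) ^ (b + 2) * 0 ^ b <
        Mconst m lam ϑ (j + 1) := by
      -- The excess `1/(2λ)` over the limiting factor `2/λ` makes the inequality strict.
      have h5 : 5 / (2 * lam) = 2 / lam + 1 / (2 * lam) := by field_simp; norm_num
      have h1 : 0 < 1 / (2 * lam) := by positivity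
      rcases Nat.eq_zero_or_pos b with rfl | hb
      · rw [Mconst, if_neg (by omega), if_pos (by omega), zero_add, hsq, h5]
        nlinarith
      · rw [Mconst, if_pos (by omega), zero_pow hb.ne', h5]
        nlinarith
    filter_upwards [hpos, hlim.eventually (eventually_lt_nhds hlt)] with δ hδ hle
    have heps : epsPower m (δ ^ 2) (j + 1) = (δ ^ 2) ^ 2 / (δ ^ 2) ^ (b + 2 + 1) := by
      have : (((j + 1 : ℕ) : ℤ) - ((m : ℤ) - 1)) = ((2 : ℕ) : ℤ) - ((b + 2 + 1 : ℕ) : ℤ) := by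
        omega
      rw [epsPower, if_pos (by omega), this, zpow_sub₀ (by positivity), zpow_natCast, zpow_natCast]
    have hfac : δ / δ ^ (b + 2 + 1) = δ ^ b * ((δ ^ 2) ^ 2 / (δ ^ 2) ^ (b + 2 + 1)) := by
      field_simp
      ring
    rw [heps, hfac, ← mul_assoc, ← add_mul]
    exact mul_le_mul_of_nonneg_right hle.le (by positivity)
  · have hlim := (hP.mul (hid.pow (2 - a))).add hR
    have hlt : 2 / lam * vandermondeSum m ϑ (j + 1) * 0 ^ (2 - a) + √(2 / lam) ^ a <
        Mconst m lam ϑ (j + 1) := by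
      rw [zero_pow (by omega), mul_zero, zero_add, Mconst, if_neg (by omega), if_neg (by omega)]
      have : a = 0 ∨ a = 1 := by omega
      rcases this with rfl | rfl
      · rw [if_neg (by omega)]; norm_num
      · rw [if_pos (by omega), pow_one, lt_div_iff₀ (by positivity), ← Real.sqrt_mul (by positivity)]
        have : 2 / lam * (2 * lam) = 2 ^ 2 := by field_simp
        rw [this, Real.sqrt_sq (by norm_num)]
        norm_num
    filter_upwards [hpos, hlim.eventually (eventually_lt_nhds hlt)] with δ hδ hle
    have heps : epsPower m (δ ^ 2) (j + 1) = δ / δ ^ (a + 1) := by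
      have h1 : (((j + 1 : ℕ) : ℝ) - (m : ℝ)) / 2 = -(a : ℝ) / 2 := by
        rw [← hj]; push_cast; ring
      rw [epsPower, if_neg (by omega), h1, ← Real.rpow_natCast_mul hδ.le]
      have h2 : ((2 : ℕ) : ℝ) * (-(a : ℝ) / 2) = -(a : ℝ) := by push_cast; ring
      rw [h2, Real.rpow_neg hδ.le, Real.rpow_natCast]
      field_simp
      rw [pow_succ]
    have hfac : (δ ^ 2) ^ 2 / (δ ^ 2) ^ (a + 1) = δ ^ (2 - a) * (δ / δ ^ (a + 1)) := by
      have : a = 0 ∨ a = 1 := by omega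
      rcases this with rfl | rfl <;> field_simp <;> norm_num <;> ring
    rw [heps, hfac, ← mul_assoc, ← add_mul]
    exact mul_le_mul_of_nonneg_right hle.le (by positivity)

theorem eventually_bound {m : ℕ} (hm : 2 ≤ m) {θ : ℝ} (hθ : Real.sin θ ≠ 0) {lam : ℝ}
    (hlam : 0 < lam) {c : ℕ → ℝ} {ϑ : ℕ → ℂ} (hc : GainChoice m θ lam c ϑ) :
    ∀ᶠ δ in 𝓝[>] (0 : ℝ), ∀ (ξ : EuclideanSpace ℝ (Fin m × Fin 2)) (s : ℕ) (j : Fin m) (e : Fin 2),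
      |((closedLoop m θ lam c (δ ^ 2) ^ s) *ᵥ ξ.ofLp) (j, e)| ≤
        ‖ξ‖ * Mconst m lam ϑ ((j : ℕ) + 1) * specRadius (closedLoop m θ lam c (δ ^ 2)) ^ s *
          epsPower m (δ ^ 2) ((j : ℕ) + 1) := by
  have hl0 : (lam : ℂ) ≠ 0 := by exact_mod_cast hlam.ne'
  have hg := norm_cplxGain hm hc
  have hg0 : cplxGain c (m - 2) ≠ 0 := norm_ne_zero_iff.1 (by rw [hg]; exact one_ne_zero)
  obtain ⟨y₀, hy₀⟩ := IsAlgClosed.exists_pow_nat_eq (-(2 / (lam : ℂ)) / cplxGain c (m - 2))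
    (n := 2) two_pos
  have hy : cplxGain c (m - 2) * y₀ ^ 2 + 2 / (lam : ℂ) = 0 := by
    rw [hy₀, mul_div_cancel₀ _ hg0, neg_add_cancel]
  have hy0 : y₀ ≠ 0 := by
    rintro rfl
    simp [hl0] at hy
  let y : Bool → ℂ := fun b => if b then y₀ else -y₀
  have hyb : ∀ b, cplxGain c (m - 2) * y b ^ 2 + 2 / (lam : ℂ) = 0 := by
    intro b
    cases b <;> simp [y, hy]
  have hyb0 : ∀ b, y b ≠ 0 := by
    intro b
    cases b <;> simp [y, hy0]
  have hyinj : ∀ b b', b ≠ b' → (y b)⁻¹ ≠ (y b')⁻¹ := by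
    intro b b' hbb h
    have h1 := inv_injective h
    have h2 : y₀ ≠ -y₀ := fun h => hy0 (self_eq_neg.1 h)
    cases b <;> cases b' <;> simp [y] at hbb h1
    · exact h2 h1.symm
    · exact h2 h1
  -- For `m = 2` the index set is empty and only the two fast branches remain, so no case
  -- distinction is needed.
  have hm3 : ∀ n ∈ Finset.Icc 3 m, 3 ≤ m := fun n hn => by
    have := Finset.mem_Icc.1 hn; omega
  choose zA vA lA CA hzA hCA hevA using fun n : ↥(Finset.Icc 3 m) =>
    exists_slow_branch (hm3 n n.2) hθ hlam hc n.2
  choose zB vB lB CB hzB hCB hevB using fun b : Bool => exists_fast_branch hm hθ hlam hg (hyb b)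
  set E := Complex.exp (θ * Complex.I) with hE
  have hpos : ∀ᶠ δ in 𝓝[>] (0 : ℝ), 0 < δ := eventually_mem_nhdsWithin
  have hid : Tendsto (fun δ : ℝ => δ) (𝓝[>] 0) (𝓝 0) := tendsto_id.mono_left nhdsWithin_le_nhds
  have hsq : Tendsto (fun δ : ℝ => δ ^ 2) (𝓝[>] 0) (𝓝[>] 0) := by
    refine tendsto_nhdsWithin_iff.2 ⟨?_, ?_⟩
    · simpa using hid.pow 2
    · filter_upwards [hpos] with δ hδ using pow_pos hδ 2
  have hcast : Tendsto (fun δ : ℝ => (δ : ℂ)) (𝓝[>] 0) (𝓝 0) := by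
    have := (Complex.continuous_ofReal.tendsto 0).comp hid
    rwa [Complex.ofReal_zero] at this
  -- The common parameter is `δ = √ε`: slow branches are parametrised by `ε` itself, so they are
  -- evaluated at `δ ^ 2`.
  let Z : ℝ → ↥(Finset.Icc 3 m) ⊕ Bool → ℂ := fun δ =>
    Sum.elim (fun n => zA n (δ ^ 2)) (fun b => zB b δ)
  let V : ℝ → ↥(Finset.Icc 3 m) ⊕ Bool → Fin m × Fin 2 → ℂ := fun δ =>
    Sum.elim (fun n => vA n (δ ^ 2)) (fun b => vB b δ)
  let Λ : ℝ → ↥(Finset.Icc 3 m) ⊕ Bool → Fin m × Fin 2 → ℂ := fun δ =>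
    Sum.elim (fun n => lA n (δ ^ 2)) (fun b => lB b δ)
  have hzA1 : ∀ n, Tendsto (fun δ : ℝ => (zA n (δ ^ 2) - E) / (δ : ℂ) ^ 2) (𝓝[>] 0) (𝓝 (ϑ n)) := by
    intro n
    have := (hzA n).comp hsq
    refine this.congr fun δ => ?_
    simp
  have hzA2 : ∀ n, Tendsto (fun δ : ℝ => (zA n (δ ^ 2) - E) / (δ : ℂ)) (𝓝[>] 0) (𝓝 0) := by
    intro n
    have := (hzA1 n).mul hcast
    rw [mul_zero] at this
    refine this.congr' ?_
    filter_upwards [hpos] with δ hδ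
    have hδ' : (δ : ℂ) ≠ 0 := by exact_mod_cast hδ.ne'
    field_simp
  have hZ : ∀ n, Tendsto (fun δ => Z δ n) (𝓝[>] 0) (𝓝 E) := by
    have key : ∀ (z : ℝ → ℂ) (L : ℂ), Tendsto (fun δ : ℝ => (z δ - E) / (δ : ℂ)) (𝓝[>] 0) (𝓝 L) →
        Tendsto z (𝓝[>] 0) (𝓝 E) := by
      intro z L hL
      have := (hL.mul hcast).add_const E
      rw [mul_zero, zero_add] at this
      refine this.congr' ?_
      filter_upwards [hpos] with δ hδ
      have hδ' : (δ : ℂ) ≠ 0 := by exact_mod_cast hδ.ne'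
      field_simp
      ring
    rintro (n | b)
    · exact key _ _ (hzA2 n)
    · exact key _ _ (hzB b)
  have hEconj : E ≠ starRingEnd ℂ E := by
    intro h
    have h1 := congrArg Complex.im h
    rw [Complex.conj_im, hE, Complex.exp_ofReal_mul_I_im] at h1
    exact hθ (by linarith)
  -- All eigenvalues share the limit `E`, so they are separated after rescaling `Z - E`: by `δ ^ 2`
  -- for two slow ones, by `δ` otherwise.
  have hne : ∀ n k, n ≠ k → ∀ᶠ δ in 𝓝[>] (0 : ℝ), Z δ n ≠ Z δ k := by
    rintro (n | b) (k | b') hnk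
    · have h1 : ϑ n ≠ ϑ k := fun h => hnk (congrArg _ (Subtype.ext
        (hc.distinct (hm3 n n.2) (Finset.mem_Icc.1 n.2) (Finset.mem_Icc.1 k.2) h)))
      filter_upwards [eventually_ne_of_tendsto (hzA1 n) (hzA1 k) h1] with δ hδ h
      exact hδ (by simp only [Z, Sum.elim_inl] at h; rw [h])
    · filter_upwards [eventually_ne_of_tendsto (hzA2 n) (hzB b') (inv_ne_zero (hyb0 b')).symm] with δ hδ h
      exact hδ (by simp only [Z, Sum.elim_inl, Sum.elim_inr] at h; rw [h])
    · filter_upwards [eventually_ne_of_tendsto (hzB b) (hzA2 k) (inv_ne_zero (hyb0 b))] with δ hδ h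
      exact hδ (by simp only [Z, Sum.elim_inl, Sum.elim_inr] at h; rw [h])
    · filter_upwards [eventually_ne_of_tendsto (hzB b) (hzB b') (hyinj b b' fun h => hnk (congrArg _ h))]
        with δ hδ h
      exact hδ (by simp only [Z, Sum.elim_inr] at h; rw [h])
  have hne' : ∀ n k, ∀ᶠ δ in 𝓝[>] (0 : ℝ), Z δ n ≠ starRingEnd ℂ (Z δ k) := fun n k =>
    eventually_ne_of_tendsto (hZ n) ((Complex.continuous_conj.tendsto E).comp (hZ k)) hEconj
  have hmain : ∀ j : Fin m, ∀ᶠ δ in 𝓝[>] (0 : ℝ),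
      (∑ n, CA n (m - j) (δ ^ 2)) * ((δ ^ 2) ^ 2 / (δ ^ 2) ^ (m - (j : ℕ))) +
        (∑ b, CB b (m - j) δ) * (δ / δ ^ (m - (j : ℕ))) ≤
      Mconst m lam ϑ (j + 1) * epsPower m (δ ^ 2) (j + 1) := by
    intro j
    obtain ⟨a, ha⟩ := Nat.exists_eq_add_of_lt j.2
    have hja : m - (j : ℕ) = a + 1 := by omega
    simp only [hja]
    refine eventually_le_Mconst_mul_epsPower hlam hc (by omega) ?_ ?_
    · have h1 : Tendsto (fun δ : ℝ => ∑ n, CA n (a + 1) (δ ^ 2)) (𝓝[>] 0)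
          (𝓝 (∑ n : ↥(Finset.Icc 3 m), 2 / lam * (‖ϑ n‖ ^ (j : ℕ) /
            ∏ k ∈ (Finset.Icc 3 m).erase n, ‖ϑ k - ϑ n‖))) :=
        tendsto_finsetSum _ fun n _ => by
          have := (hCA n j j.2).comp hsq
          rwa [hja] at this
      rw [← Finset.mul_sum, Finset.sum_coe_sort (Finset.Icc 3 m) (fun n => ‖ϑ n‖ ^ (j : ℕ) /
            ∏ k ∈ (Finset.Icc 3 m).erase n, ‖ϑ k - ϑ n‖)] at h1
      exact h1
    · have h1 : Tendsto (fun δ : ℝ => ∑ b, CB b (a + 1) δ) (𝓝[>] 0)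
          (𝓝 (∑ _b : Bool, √(2 / lam) ^ a / 2)) := tendsto_finsetSum _ fun b _ => hCB b a
      rw [Fintype.sum_bool, add_halves] at h1
      exact h1
  have hcard : Fintype.card (Fin m × Fin 2) = 2 * Fintype.card (↥(Finset.Icc 3 m) ⊕ Bool) := by
    simp
    omega
  have hevA' := eventually_all.2 fun n => hsq.eventually (hevA n)
  filter_upwards [hpos, hevA', eventually_all.2 hevB, eventually_all.2 hmain,
    eventually_all.2 fun n => eventually_all.2 fun k => eventually_imp_distrib_left.2 (hne n k),
    eventually_all.2 fun n => eventually_all.2 fun k => hne' n k]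
    with δ hδ hA hB hM hinj hconj ξ s j e
  simp only [pow_one] at hA
  have hle := abs_pow_mulVec_le hcard (closedLoop m θ lam c (δ ^ 2)) (Z δ) (V δ) (Λ δ)
    (by rintro (n | b); exacts [(hA n).1, (hB b).1])
    (by rintro (n | b); exacts [(hA n).2.1, (hB b).2.1])
    (by rintro (n | b); exacts [(hA n).2.2.1, (hB b).2.2.1])
    (fun n k h => by_contra fun hnk => hinj n k hnk h) hconj ξ.ofLp s (j, e)
  refine hle.trans ?_
  have hρ : 0 ≤ specRadius (closedLoop m θ lam c (δ ^ 2)) := ENNReal.toReal_nonneg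
  have hsum : ∑ n, 2 * ‖Λ δ n ⬝ᵥ (fun q => (ξ.ofLp q : ℂ))‖ * ‖V δ n (j, e)‖ / ‖Λ δ n ⬝ᵥ V δ n‖ ≤
      ‖ξ‖ * (Mconst m lam ϑ (j + 1) * epsPower m (δ ^ 2) (j + 1)) := by
    refine le_trans ?_ (mul_le_mul_of_nonneg_left (hM j) (norm_nonneg ξ))
    rw [Fintype.sum_sum_type, mul_add, Finset.sum_mul, Finset.sum_mul, Finset.mul_sum,
      Finset.mul_sum]
    refine add_le_add (Finset.sum_le_sum fun n _ => ?_) (Finset.sum_le_sum fun b _ => ?_)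
    · exact (hA n).2.2.2 ξ j e
    · have := (hB b).2.2.2 ξ j e
      rwa [zero_add, pow_one] at this
  calc _ ≤ specRadius (closedLoop m θ lam c (δ ^ 2)) ^ s *
        (‖ξ‖ * (Mconst m lam ϑ (j + 1) * epsPower m (δ ^ 2) (j + 1))) :=
        mul_le_mul_of_nonneg_left hsum (pow_nonneg hρ s)
    _ = _ := by ring

end Oscillator

end

theorem mainTheorem4 (m : ℕ) (hm : 2 ≤ m) (θ : ℝ) (hθ : Real.sin θ ≠ 0)
    (lam : ℝ) (hlam : 0 < lam) (c : ℕ → ℝ) (ϑ : ℕ → ℂ)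
    (hc : Oscillator.GainChoice m θ lam c ϑ) :
    ∃ ε₀ : ℝ, 0 < ε₀ ∧ ∀ ε : ℝ, 0 < ε → ε < ε₀ →
      ∀ (ξ : EuclideanSpace ℝ (Fin m × Fin 2)) (s : ℕ) (j : Fin m) (e : Fin 2),
        |((Oscillator.closedLoop m θ lam c ε ^ s) *ᵥ ξ.ofLp) (j, e)| ≤
          ‖ξ‖ * Oscillator.Mconst m lam ϑ ((j : ℕ) + 1) *
            Oscillator.specRadius (Oscillator.closedLoop m θ lam c ε) ^ s *
            Oscillator.epsPower m ε ((j : ℕ) + 1) := by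
  obtain ⟨δ₀, hδ₀, hsub⟩ :=
    mem_nhdsGT_iff_exists_Ioo_subset.1 (Oscillator.eventually_bound hm hθ hlam hc)
  have hδ₀ : 0 < δ₀ := hδ₀
  refine ⟨δ₀ ^ 2, pow_pos hδ₀ 2, fun ε hε hεlt => ?_⟩
  have hmem : √ε ∈ Set.Ioo 0 δ₀ := ⟨Real.sqrt_pos.2 hε, (Real.sqrt_lt' hδ₀).2 hεlt⟩
  have := hsub hmem
  simp only [Set.mem_ofPred_eq, Real.sq_sqrt hε.le] at this
  exact this
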